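/- Let $\beta\ge 1$ be an integer. For an integer $m\ge 0$ let $K_{(2^m)}$ be the complete multipartite graph with $m$ parts of size $2$, viewed as the incomparability graph of the poset $P_m$ that is the disjoint union of $m$ chains with two elements each (two vertices are adjacent if and only if they are incomparable in $P_m$). Let $N_{\mathrm{sp}}(K_{(2^m)})$ be the number of sequences $(v_1,\dots,v_{2m})$ containing every vertex of $K_{(2^m)}$ exactly once and satisfying $v_i\not\le v_{i+1}$ in $P_m$ for $1\le i\le 2m-1$ (so that $N_{\mathrm{sp}}(K_{(2^0)})=1$). For a finite graph $G$ let $X_G=\sum_{c}\prod_{v\in V(G)}x_{c(v)}$ be its chromatic symmetric function, where $c$ runs over all proper colorings of $G$ by positive integers, and let $[s_\lambda]X_G$ be the coefficient of the Schur function $s_\lambda$ in the (existing and unique) expansion of $X_G$ as a finite rational linear combination of Schur functions. Then for all integers $C,D\ge 0$ with $2C+D=2\beta$, $$[s_{(2^C,1^D)}]X_{K_{(2^\beta)}}=\frac{\beta!}{(\beta-C)!}\cdot N_{\mathrm{sp}}(K_{(2^{\beta-C})}),$$ where $(2^C,1^D)$ is the partition with $C$ parts equal to $2$ and $D$ parts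 equal to $1$. In particular, all these coefficients are non-negative. -/

import Mathlib

/-- The incomparability graph `inc(P)` of a poset `P`: two elements are adjacent exactly when they
are incomparable. -/
def incGraph (P : Type*) [PartialOrder P] : SimpleGraph P where
  Adj x y := ¬ x ≤ y ∧ ¬ y ≤ x
  symm := ⟨fun _ _ h => ⟨h.2, h.1⟩⟩
  loopless := ⟨fun x h => h.1 (le_refl x)⟩

/-- The poset that is the disjoint union of chains of lengths `l 0, l 1, …` (elements of different
chains are incomparable; this is Mathlib's order on a sigma type). -/
abbrev DisjointChains {k : ℕ} (l : Fin k → ℕ) : Type :=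
  Σ i : Fin k, Fin (l i)

/-- The complete multipartite graph with parts of sizes `l 0, l 1, …`, viewed as the
incomparability graph of the disjoint union of chains of these lengths. -/
abbrev multipartite {k : ℕ} (l : Fin k → ℕ) : SimpleGraph (DisjointChains l) :=
  incGraph (DisjointChains l)

/-- The graph above is indeed Mathlib's complete multipartite graph. -/
theorem multipartite_eq {k : ℕ} (l : Fin k → ℕ) :
    multipartite l = SimpleGraph.completeMultipartiteGraph (fun i => Fin (l i)) := by
  ext ⟨i, a⟩ ⟨j, b⟩
  simp only [multipartite, incGraph, SimpleGraph.comap_adj, SimpleGraph.top_adj]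
  constructor
  · rintro ⟨h1, h2⟩ rfl
    rw [Sigma.mk_le_mk_iff] at h1 h2
    exact (le_total a b).elim h1 h2
  · intro h
    refine ⟨fun h' => h (Sigma.le_def.1 h').1, fun h' => h (Sigma.le_def.1 h').1.symm⟩

/-- The number `N_sp(inc(P))` of spanning non-increasing sequences of a finite poset `P`: lists
`(v₁, …, v_k)` containing every element of `P` exactly once, with `vᵢ ≰ vᵢ₊₁` for all `i`. -/
noncomputable def numSpanningNonincreasing (P : Type*) [PartialOrder P] : ℕ :=
  Nat.card {s : List P // s.Nodup ∧ (∀ x, x ∈ s) ∧ s.IsChain (fun a b => ¬ a ≤ b)}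

/-- The chromatic symmetric function of a finite graph `G`, a formal power series over `ℚ` in
countably many variables (indexed by `ℕ`): the coefficient of the monomial `x ^ m` is the (finite)
number of proper colorings `c : V → ℕ` of `G` with `∏ v, x_{c v} = x ^ m`. -/
noncomputable def chromaticSymm {V : Type*} [Fintype V] (G : SimpleGraph V) :
    MvPowerSeries ℕ ℚ :=
  fun m => (Nat.card {c : G.Coloring ℕ // ∑ v, Finsupp.single (c v) 1 = m} : ℚ)

/-- The Schur function `s_μ`: the coefficient of the monomial `x ^ m` is the (finite) number of
semistandard Young tableaux of shape `μ` and weight `x ^ m`. The letters are `0, 1, 2, …`, matching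
the indexing of the variables by `ℕ`. -/
noncomputable def schur (μ : YoungDiagram) : MvPowerSeries ℕ ℚ :=
  fun m => (Nat.card {T : SemistandardYoungTableau μ //
    ∑ c ∈ μ.cells, Finsupp.single (T c.1 c.2) 1 = m} : ℚ)

/-- `a` is a family of coefficients expanding `f` as a finite linear combination of Schur
functions: `f = ∑_μ a_μ s_μ`. -/
def IsSchurExpansion (f : MvPowerSeries ℕ ℚ) (a : YoungDiagram →₀ ℚ) : Prop :=
  f = a.sum fun μ r => r • schur μ

open Classical in
/-- `[s_μ] f`, the coefficient of `s_μ` in the expansion of `f` in Schur functions (with value `0`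
if there is no such expansion). -/
noncomputable def schurCoeff (μ : YoungDiagram) (f : MvPowerSeries ℕ ℚ) : ℚ :=
  if h : ∃ a, IsSchurExpansion f a then h.choose μ else 0

theorem sortedGE_twos_ones (C D : ℕ) :
    (List.replicate C 2 ++ List.replicate D 1).SortedGE := by
  apply List.Pairwise.sortedGE
  simp only [List.pairwise_append, List.pairwise_replicate, List.mem_replicate]
  refine ⟨Or.inr le_rfl, Or.inr le_rfl, ?_⟩
  rintro a ⟨-, rfl⟩ b ⟨-, rfl⟩
  norm_num

/-- The partition `(2^C, 1^D)`. -/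
def twosOnes (C D : ℕ) : YoungDiagram :=
  YoungDiagram.ofRowLens (List.replicate C 2 ++ List.replicate D 1) (sortedGE_twos_ones C D)

/-! Both sides are compared monomial by monomial. The monomials that matter have degree `2n` and
exponents at most 2; let `j` variables have exponent 2 and `r = 2(n - j)` have exponent 1.

A proper colouring of `K_{(2^n)}` gives each part a pair of colours, disjoint from those of the
other parts. The `j` repeated colours fill whole parts in `n!/(n-j)!` ways and the others go
bijectively to the `r` remaining vertices, so the coefficient in `X` is `n! r!/(n-j)!`
(`ncard_disjointPairs`). A tableau of shape `(2^C, 1^D)` is a pair of column sets; colours of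
exponent 2 lie in both columns and the others form a ballot word with letters `±1`, so the
coefficient in the Schur function is `ballotNumber r D` (`coeff_schur_twosOnes`).

With `N_k` the number of spanning sequences for `k` chains, what remains is `∑ k, ballotNumber (2s)
(2k) * N_k / k! = (2s)! / s!`. Let `L` be the linear functional on polynomials with `L(x^(2k)) =
(2k)!/k!` that kills odd powers, and let `U_d` be the rescaled Chebyshev polynomials, `x U_d =
U_(d+1) + U_(d-1)`. Then `x^n = ∑ d, ballotNumber n d * U_d`
(`sum_ballotNumber_mul_chebyshevMoment`). Inclusion–exclusion over the chains whose two elements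
occur consecutively in increasing order gives `N_k = ∑ i, (-1)^i (k choose i) (2k-i)!`, which is `k!
L(U_(2k))` (`chebyshevMoment_even`). Applying `L` to `x^(2s)` gives the identity.

Uniqueness of the expansion is the linear independence of Schur functions, by triangularity in the
dominance order. -/

/-! ### Linear independence of Schur functions -/

namespace YoungDiagram

/-- The number of cells in the first `k` rows. -/
def firstRows (μ : YoungDiagram) (k : ℕ) : ℕ :=
  (μ.cells.filter fun c => c.1 < k).card

theorem firstRows_succ (μ : YoungDiagram) (k : ℕ) :
    μ.firstRows (k + 1) = μ.firstRows k + μ.rowLen k := by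
  rw [firstRows, firstRows, rowLen_eq_card, row, ← Finset.card_union_of_disjoint]
  · congr 1
    ext c
    simp only [Finset.mem_filter, Finset.mem_union, mem_cells]
    have : c.1 < k + 1 ↔ c.1 < k ∨ c.1 = k := by omega
    rw [this]
    tauto
  · rw [Finset.disjoint_filter]
    intro c _ h1 h2
    omega

/-- The pointwise order on `firstRows` is dominance; injectivity supplies its antisymmetry. -/
theorem firstRows_injective : Function.Injective firstRows := by
  intro μ ν h
  have hr : ∀ i, μ.rowLen i = ν.rowLen i := fun i => by
    have h1 := μ.firstRows_succ i
    have h2 := ν.firstRows_succ i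
    rw [h] at h1
    omega
  ext ⟨i, j⟩
  simp only [mem_cells, mem_iff_lt_rowLen, hr]

end YoungDiagram

namespace SemistandardYoungTableau

variable {μ : YoungDiagram}

/-- The exponent vector of the monomial of a tableau. -/
noncomputable def weight (T : SemistandardYoungTableau μ) : ℕ →₀ ℕ :=
  ∑ c ∈ μ.cells, Finsupp.single (T c.1 c.2) 1

theorem weight_apply (T : SemistandardYoungTableau μ) (x : ℕ) :
    T.weight x = (μ.cells.filter fun c => T c.1 c.2 = x).card := by
  rw [weight, Finsupp.finsetSum_apply, Finset.card_filter]
  exact Finset.sum_congr rfl fun c _ => by rw [Finsupp.single_apply]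

theorem mem_support_weight (T : SemistandardYoungTableau μ) {c : ℕ × ℕ} (hc : c ∈ μ.cells) :
    T c.1 c.2 ∈ T.weight.support := by
  rw [Finsupp.mem_support_iff, weight_apply]
  exact Finset.card_ne_zero_of_mem (Finset.mem_filter.2 ⟨hc, rfl⟩)

theorem le_entry (T : SemistandardYoungTableau μ) {i j : ℕ} (h : (i, j) ∈ μ) : i ≤ T i j := by
  induction i with
  | zero => exact Nat.zero_le _
  | succ i ih =>
    have h1 := ih (μ.up_left_mem (Nat.le_succ i) le_rfl h)
    have h2 := T.col_strict (Nat.lt_add_one i) h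
    omega

instance finite_weight_eq (m : ℕ →₀ ℕ) :
    Finite {T : SemistandardYoungTableau μ // T.weight = m} := by
  let f : {T : SemistandardYoungTableau μ // T.weight = m} → (μ.cells → m.support) :=
    fun T c => ⟨T.1 c.1.1 c.1.2, by
      have := T.1.mem_support_weight c.2
      rwa [T.2] at this⟩
  refine Finite.of_injective f fun T T' h => Subtype.ext (ext fun i j => ?_)
  by_cases hc : (i, j) ∈ μ
  · exact congrArg Subtype.val (congrFun h ⟨(i, j), (μ.mem_cells _).2 hc⟩)
  · rw [T.1.zeros hc, T'.1.zeros hc]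

theorem card_entry_lt (T : SemistandardYoungTableau μ) (k : ℕ) :
    (μ.cells.filter fun c => T c.1 c.2 < k).card = ∑ x ∈ Finset.range k, T.weight x := by
  rw [Finset.card_eq_sum_card_fiberwise (f := fun c => T c.1 c.2) (t := Finset.range k)]
  · refine Finset.sum_congr rfl fun x hx => ?_
    rw [weight_apply, Finset.filter_filter]
    congr 1
    refine Finset.filter_congr fun c _ => ?_
    rw [Finset.mem_range] at hx
    constructor
    · exact fun h => h.2
    · exact fun h => ⟨h ▸ hx, h⟩
  · intro c hc
    simpa using (Finset.mem_filter.1 hc).2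

/-- Columns are strict, so an entry in row `i` is at least `i`, and all entries below `k` sit in the
first `k` rows. In the highest weight tableau these entries fill the first `k` rows exactly. -/
theorem firstRows_le_of_weight_eq {ν : YoungDiagram} (T : SemistandardYoungTableau μ)
    (h : T.weight = (highestWeight ν).weight) : ν.firstRows ≤ μ.firstRows := by
  intro k
  have h1 := T.card_entry_lt k
  rw [h, ← card_entry_lt] at h1
  have h2 : ν.firstRows k = (ν.cells.filter fun c => highestWeight ν c.1 c.2 < k).card := by
    rw [YoungDiagram.firstRows]
    congr 1
    refine Finset.filter_congr fun c hc => ?_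
    rw [highestWeight_apply, if_pos ((ν.mem_cells _).1 hc)]
  rw [h2, ← h1, YoungDiagram.firstRows]
  refine Finset.card_le_card fun c hc => ?_
  rw [Finset.mem_filter] at hc ⊢
  exact ⟨hc.1, (T.le_entry ((μ.mem_cells _).1 hc.1)).trans_lt hc.2⟩

end SemistandardYoungTableau

open SemistandardYoungTableau

theorem coeff_schur (μ : YoungDiagram) (m : ℕ →₀ ℕ) :
    MvPowerSeries.coeff m (schur μ) =
      (Nat.card {T : SemistandardYoungTableau μ // T.weight = m} : ℚ) := rfl

theorem coeff_schur_highestWeight_ne_zero (μ : YoungDiagram) :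
    MvPowerSeries.coeff (highestWeight μ).weight (schur μ) ≠ 0 := by
  rw [coeff_schur, Nat.cast_ne_zero]
  have : Nonempty {T : SemistandardYoungTableau μ // T.weight = (highestWeight μ).weight} :=
    ⟨⟨_, rfl⟩⟩
  exact Nat.card_pos.ne'

theorem firstRows_le_of_coeff_schur_ne_zero {μ ν : YoungDiagram}
    (h : MvPowerSeries.coeff (highestWeight ν).weight (schur μ) ≠ 0) :
    ν.firstRows ≤ μ.firstRows := by
  rw [coeff_schur, Nat.cast_ne_zero] at h
  obtain ⟨⟨T, hT⟩⟩ := (Nat.card_ne_zero.1 h).1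
  exact T.firstRows_le_of_weight_eq hT

/-- In a vanishing combination take a dominance-maximal `ν` in the support and read off the
coefficient at its highest weight monomial. Any `μ` contributing there dominates `ν`, hence equals
it. -/
theorem linearIndependent_schur : LinearIndependent ℚ schur := by
  rw [linearIndependent_iff]
  intro a ha
  by_contra hne
  obtain ⟨ν, hν, hmax⟩ := a.support.exists_maximalFor YoungDiagram.firstRows
    (Finsupp.support_nonempty_iff.2 hne)
  have h := congrArg (MvPowerSeries.coeff (highestWeight ν).weight) ha
  rw [Finsupp.linearCombination_apply, Finsupp.sum, map_sum, map_zero,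
    Finset.sum_eq_single ν] at h
  · rw [map_smul, smul_eq_mul] at h
    exact mul_ne_zero (Finsupp.mem_support_iff.1 hν) (coeff_schur_highestWeight_ne_zero ν) h
  · intro μ hμ hμν
    rw [map_smul, smul_eq_mul]
    by_contra h0
    have hle := firstRows_le_of_coeff_schur_ne_zero (right_ne_zero_of_mul h0)
    exact hμν (YoungDiagram.firstRows_injective ((hmax hμ hle).antisymm hle))
  · exact fun h0 => absurd hν h0

theorem IsSchurExpansion.unique {f : MvPowerSeries ℕ ℚ} {a b : YoungDiagram →₀ ℚ}
    (ha : IsSchurExpansion f a) (hb : IsSchurExpansion f b) : a = b :=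
  linearIndependent_schur (ha.symm.trans hb)

theorem IsSchurExpansion.schurCoeff_eq {f : MvPowerSeries ℕ ℚ} {a : YoungDiagram →₀ ℚ}
    (ha : IsSchurExpansion f a) (μ : YoungDiagram) : schurCoeff μ f = a μ := by
  have h : ∃ a, IsSchurExpansion f a := ⟨a, ha⟩
  rw [schurCoeff, dif_pos h, h.choose_spec.unique ha]

/-! ### Ballot numbers and ballot pairs of sets -/

/-- The number of words of length `n` in the letters `±1` with sum `d` and nonnegative
partial sums. -/
def ballotNumber : ℕ → ℕ → ℕ
  | 0, 0 => 1
  | 0, _ + 1 => 0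
  | n + 1, 0 => ballotNumber n 1
  | n + 1, d + 1 => ballotNumber n d + ballotNumber n (d + 2)

theorem ballotNumber_eq_zero_of_lt {n d : ℕ} (h : n < d) : ballotNumber n d = 0 := by
  induction n generalizing d with
  | zero =>
    obtain ⟨d, rfl⟩ := Nat.exists_eq_add_one_of_ne_zero (Nat.ne_of_gt h)
    rfl
  | succ n ih =>
    obtain ⟨d, rfl⟩ := Nat.exists_eq_add_one_of_ne_zero (Nat.ne_of_gt (Nat.zero_lt_of_lt h))
    rw [ballotNumber, ih (by omega), ih (by omega)]

/-- The sum of the variables with index in `A`, as an exponent vector. -/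
noncomputable def indicatorWeight (A : Finset ℕ) : ℕ →₀ ℕ :=
  ∑ x ∈ A, Finsupp.single x 1

theorem indicatorWeight_apply (A : Finset ℕ) (x : ℕ) :
    indicatorWeight A x = if x ∈ A then 1 else 0 := by
  rw [indicatorWeight, Finsupp.finsetSum_apply]
  simp [Finsupp.single_apply]

theorem degree_indicatorWeight (A : Finset ℕ) : (indicatorWeight A).degree = A.card := by
  rw [indicatorWeight, map_sum]
  simp

/-- `A` has `d` more elements than `B`, and every initial segment contains at least as many
elements of `A` as of `B`. -/
def IsBallot (d : ℕ) (A B : Finset ℕ) : Prop :=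
  A.card = B.card + d ∧ ∀ t, (B.filter (· < t)).card ≤ (A.filter (· < t)).card

/-- The pairs of sets satisfying the ballot condition with given union with multiplicities. -/
def ballotPairs (m : ℕ →₀ ℕ) (d : ℕ) : Set (Finset ℕ × Finset ℕ) :=
  {p | indicatorWeight p.1 + indicatorWeight p.2 = m ∧ IsBallot d p.1 p.2}

theorem card_filter_insert_lt {N : ℕ} {A : Finset ℕ} (hA : N ∉ A) (t : ℕ) :
    ((insert N A).filter (· < t)).card = (A.filter (· < t)).card + if N < t then 1 else 0 := by
  rw [Finset.filter_insert]
  split_ifs with h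
  · rw [Finset.card_insert_of_notMem]
    exact fun h' => hA (Finset.mem_filter.1 h').1
  · rfl

theorem filter_lt_eq_self {N t : ℕ} {A : Finset ℕ} (hA : ∀ x ∈ A, x < N) (h : N ≤ t) :
    A.filter (· < t) = A :=
  Finset.filter_true_of_mem fun x hx => (hA x hx).trans_le h

section insert

variable {N d : ℕ} {A B : Finset ℕ} (hA : ∀ x ∈ A, x < N) (hB : ∀ x ∈ B, x < N)

include hA hB

/-- Since `N` exceeds every element, only thresholds above `N` notice it, and there the initial
segments are the full sets, whose sizes are governed by the cardinality condition. -/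
theorem isBallot_insert_left : IsBallot (d + 1) (insert N A) B ↔ IsBallot d A B := by
  have hN : N ∉ A := fun h => lt_irrefl _ (hA N h)
  unfold IsBallot
  simp only [card_filter_insert_lt hN, Finset.card_insert_of_notMem hN]
  refine ⟨fun ⟨h1, h2⟩ => ⟨by omega, fun t => ?_⟩, fun ⟨h1, h2⟩ => ⟨by omega, fun t => ?_⟩⟩
  · have := h2 t
    split_ifs at this with h
    · rw [filter_lt_eq_self hA h.le, filter_lt_eq_self hB h.le]
      omega
    · exact this
  · exact (h2 t).trans (Nat.le_add_right _ _)

theorem isBallot_insert_right : IsBallot d A (insert N B) ↔ IsBallot (d + 1) A B := by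
  have hN : N ∉ B := fun h => lt_irrefl _ (hB N h)
  unfold IsBallot
  simp only [card_filter_insert_lt hN, Finset.card_insert_of_notMem hN]
  refine ⟨fun ⟨h1, h2⟩ => ⟨by omega, fun t => ?_⟩, fun ⟨h1, h2⟩ => ⟨by omega, fun t => ?_⟩⟩
  · exact (Nat.le_add_right _ _).trans (h2 t)
  · split_ifs with h
    · rw [filter_lt_eq_self hA h.le, filter_lt_eq_self hB h.le]
      omega
    · exact h2 t

theorem isBallot_insert_insert : IsBallot d (insert N A) (insert N B) ↔ IsBallot d A B := by
  have hN : N ∉ A := fun h => lt_irrefl _ (hA N h)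
  have hN' : N ∉ B := fun h => lt_irrefl _ (hB N h)
  unfold IsBallot
  simp only [card_filter_insert_lt hN, Finset.card_insert_of_notMem hN,
    card_filter_insert_lt hN', Finset.card_insert_of_notMem hN', add_le_add_iff_right]
  have : A.card + 1 = B.card + 1 + d ↔ A.card = B.card + d := by omega
  rw [this]

/-- A word with sum 0 cannot end in `+1`: just before the last letter the partial sum would be `-1`.
-/
theorem not_isBallot_zero_insert_left : ¬ IsBallot 0 (insert N A) B := by
  have hN : N ∉ A := fun h => lt_irrefl _ (hA N h)
  rintro ⟨h1, h2⟩
  have := h2 N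
  rw [card_filter_insert_lt hN, filter_lt_eq_self hA le_rfl, filter_lt_eq_self hB le_rfl,
    if_neg (lt_irrefl _)] at this
  rw [Finset.card_insert_of_notMem hN] at h1
  omega

end insert

theorem indicatorWeight_insert {N : ℕ} {A : Finset ℕ} (hA : N ∉ A) :
    indicatorWeight (insert N A) = Finsupp.single N 1 + indicatorWeight A :=
  Finset.sum_insert hA

theorem finite_ballotPairs (m : ℕ →₀ ℕ) (d : ℕ) : (ballotPairs m d).Finite := by
  refine Set.Finite.subset (Finset.finite_toSet (m.support.powerset ×ˢ m.support.powerset)) ?_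
  rintro ⟨A, B⟩ ⟨rfl, -⟩
  rw [Finset.mem_coe, Finset.mem_product, Finset.mem_powerset, Finset.mem_powerset]
  constructor <;> intro x hx <;>
    simp only [Finsupp.mem_support_iff, Finsupp.add_apply, indicatorWeight_apply] <;> simp_all

section recursion

variable {m : ℕ →₀ ℕ} {N : ℕ} (hm : ∀ x ∈ m.support, x < N)

include hm

theorem lt_of_mem_of_mem_ballotPairs {d : ℕ} {A B : Finset ℕ} (h : (A, B) ∈ ballotPairs m d) :
    (∀ x ∈ A, x < N) ∧ ∀ x ∈ B, x < N := by
  obtain ⟨rfl, -⟩ := h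
  constructor <;> intro x hx <;> apply hm <;>
    simp only [Finsupp.mem_support_iff, Finsupp.add_apply, indicatorWeight_apply] <;> simp_all

theorem indicatorWeight_erase_add {e : ℕ} {A B : Finset ℕ}
    (h : indicatorWeight A + indicatorWeight B = Finsupp.single N e + m) :
    indicatorWeight (A.erase N) + indicatorWeight (B.erase N) = m ∧
      ((if N ∈ A then 1 else 0) + (if N ∈ B then 1 else 0)) = e := by
  have hN : m N = 0 := by
    by_contra h0
    exact lt_irrefl _ (hm N (Finsupp.mem_support_iff.2 h0))
  have key := fun x => DFunLike.congr_fun h x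
  simp only [Finsupp.add_apply, indicatorWeight_apply, Finsupp.single_apply] at key
  constructor
  · ext x
    have := key x
    simp only [Finsupp.add_apply, indicatorWeight_apply, Finset.mem_erase]
    by_cases hx : x = N
    · subst hx
      simp [hN]
    · simpa [hx, Ne.symm hx] using this
  · simpa [hN] using key N

theorem erase_lt {e : ℕ} {A B : Finset ℕ}
    (h : indicatorWeight A + indicatorWeight B = Finsupp.single N e + m) :
    (∀ x ∈ A.erase N, x < N) ∧ ∀ x ∈ B.erase N, x < N := by
  have h' := (indicatorWeight_erase_add hm h).1
  constructor <;> intro x hx <;> apply hm <;> rw [← h'] <;>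
    simp only [Finsupp.mem_support_iff, Finsupp.add_apply, indicatorWeight_apply] <;> simp_all

theorem mem_ballotPairs_iff_of_mem_notMem {d : ℕ} {A B : Finset ℕ} (hA : N ∈ A) (hB : N ∉ B) :
    (A, B) ∈ ballotPairs (Finsupp.single N 1 + m) (d + 1) ↔ (A.erase N, B) ∈ ballotPairs m d := by
  constructor
  · rintro ⟨h1, h2⟩
    have h3 := indicatorWeight_erase_add hm h1
    have h4 := erase_lt hm h1
    rw [Finset.erase_eq_of_notMem hB] at h3 h4
    refine ⟨h3.1, (isBallot_insert_left h4.1 h4.2).1 ?_⟩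
    rwa [Finset.insert_erase hA]
  · intro h
    have h4 := lt_of_mem_of_mem_ballotPairs hm h
    obtain ⟨h1, h2⟩ := h
    have := (isBallot_insert_left h4.1 h4.2).2 h2
    rw [Finset.insert_erase hA] at this
    refine ⟨?_, this⟩
    have hw := indicatorWeight_insert (Finset.notMem_erase N A)
    rw [Finset.insert_erase hA] at hw
    change indicatorWeight A + _ = _
    rw [hw, add_assoc]
    exact congrArg _ h1

theorem notMem_ballotPairs_zero_of_mem {e : ℕ} {A B : Finset ℕ} (hA : N ∈ A) (hB : N ∉ B) :
    (A, B) ∉ ballotPairs (Finsupp.single N e + m) 0 := by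
  rintro ⟨h1, h2⟩
  have h4 := erase_lt hm h1
  rw [Finset.erase_eq_of_notMem hB] at h4
  refine not_isBallot_zero_insert_left h4.1 h4.2 ?_
  rwa [Finset.insert_erase hA]

theorem mem_ballotPairs_iff_of_notMem_mem {d : ℕ} {A B : Finset ℕ} (hA : N ∉ A) (hB : N ∈ B) :
    (A, B) ∈ ballotPairs (Finsupp.single N 1 + m) d ↔
      (A, B.erase N) ∈ ballotPairs m (d + 1) := by
  constructor
  · rintro ⟨h1, h2⟩
    have h3 := indicatorWeight_erase_add hm h1
    have h4 := erase_lt hm h1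
    rw [Finset.erase_eq_of_notMem hA] at h3 h4
    refine ⟨h3.1, (isBallot_insert_right h4.1 h4.2).1 ?_⟩
    rwa [Finset.insert_erase hB]
  · intro h
    have h4 := lt_of_mem_of_mem_ballotPairs hm h
    obtain ⟨h1, h2⟩ := h
    have := (isBallot_insert_right h4.1 h4.2).2 h2
    rw [Finset.insert_erase hB] at this
    refine ⟨?_, this⟩
    have hw := indicatorWeight_insert (Finset.notMem_erase N B)
    rw [Finset.insert_erase hB] at hw
    change _ + indicatorWeight B = _
    rw [hw, add_left_comm]
    exact congrArg _ h1

theorem mem_ballotPairs_iff_of_mem_mem {d : ℕ} {A B : Finset ℕ} (hA : N ∈ A) (hB : N ∈ B) :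
    (A, B) ∈ ballotPairs (Finsupp.single N 2 + m) d ↔
      (A.erase N, B.erase N) ∈ ballotPairs m d := by
  constructor
  · rintro ⟨h1, h2⟩
    have h3 := indicatorWeight_erase_add hm h1
    have h4 := erase_lt hm h1
    refine ⟨h3.1, (isBallot_insert_insert h4.1 h4.2).1 ?_⟩
    rwa [Finset.insert_erase hA, Finset.insert_erase hB]
  · intro h
    have h4 := lt_of_mem_of_mem_ballotPairs hm h
    obtain ⟨h1, h2⟩ := h
    have := (isBallot_insert_insert h4.1 h4.2).2 h2
    rw [Finset.insert_erase hA, Finset.insert_erase hB] at this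
    refine ⟨?_, this⟩
    have hw := indicatorWeight_insert (Finset.notMem_erase N B)
    rw [Finset.insert_erase hB] at hw
    have hw' := indicatorWeight_insert (Finset.notMem_erase N A)
    rw [Finset.insert_erase hA] at hw'
    change indicatorWeight A + indicatorWeight B = _
    have h1' : indicatorWeight (A.erase N) + indicatorWeight (B.erase N) = m := h1
    rw [hw, hw', ← h1', add_add_add_comm, ← Finsupp.single_add]

theorem notMem_of_mem_ballotPairs {d : ℕ} {A B : Finset ℕ} (h : (A, B) ∈ ballotPairs m d) :
    N ∉ A ∧ N ∉ B :=
  ⟨fun h' => lt_irrefl _ ((lt_of_mem_of_mem_ballotPairs hm h).1 N h'),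
    fun h' => lt_irrefl _ ((lt_of_mem_of_mem_ballotPairs hm h).2 N h')⟩

theorem injOn_insert_left (d : ℕ) : Set.InjOn
    (fun p : Finset ℕ × Finset ℕ => (insert N p.1, p.2)) (ballotPairs m d) := by
  rintro ⟨A, B⟩ h ⟨A', B'⟩ h' heq
  rw [Prod.mk.injEq] at heq ⊢
  refine ⟨?_, heq.2⟩
  rw [← Finset.erase_insert (notMem_of_mem_ballotPairs hm h).1,
    ← Finset.erase_insert (notMem_of_mem_ballotPairs hm h').1]
  exact congrArg (Finset.erase · N) heq.1

theorem injOn_insert_right (d : ℕ) : Set.InjOn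
    (fun p : Finset ℕ × Finset ℕ => (p.1, insert N p.2)) (ballotPairs m d) := by
  rintro ⟨A, B⟩ h ⟨A', B'⟩ h' heq
  rw [Prod.mk.injEq] at heq ⊢
  refine ⟨heq.1, ?_⟩
  rw [← Finset.erase_insert (notMem_of_mem_ballotPairs hm h).2,
    ← Finset.erase_insert (notMem_of_mem_ballotPairs hm h').2]
  exact congrArg (Finset.erase · N) heq.2

theorem injOn_insert_insert (d : ℕ) : Set.InjOn
    (fun p : Finset ℕ × Finset ℕ => (insert N p.1, insert N p.2)) (ballotPairs m d) := by
  rintro ⟨A, B⟩ h ⟨A', B'⟩ h' heq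
  rw [Prod.mk.injEq] at heq ⊢
  constructor
  · rw [← Finset.erase_insert (notMem_of_mem_ballotPairs hm h).1,
      ← Finset.erase_insert (notMem_of_mem_ballotPairs hm h').1]
    exact congrArg (Finset.erase · N) heq.1
  · rw [← Finset.erase_insert (notMem_of_mem_ballotPairs hm h).2,
      ← Finset.erase_insert (notMem_of_mem_ballotPairs hm h').2]
    exact congrArg (Finset.erase · N) heq.2

theorem mem_or_mem_of_single_one {d : ℕ} {A B : Finset ℕ}
    (h : (A, B) ∈ ballotPairs (Finsupp.single N 1 + m) d) :
    (N ∈ A ∧ N ∉ B) ∨ (N ∉ A ∧ N ∈ B) := by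
  have := (indicatorWeight_erase_add hm h.1).2
  dsimp only at this
  split_ifs at this <;> simp_all

theorem ballotPairs_single_one_zero : ballotPairs (Finsupp.single N 1 + m) 0 =
    (fun p : Finset ℕ × Finset ℕ => (p.1, insert N p.2)) '' ballotPairs m 1 := by
  ext ⟨A, B⟩
  rw [Set.mem_image]
  constructor
  · intro h
    rcases mem_or_mem_of_single_one hm h with ⟨h1, h2⟩ | ⟨h1, h2⟩
    · exact absurd h (notMem_ballotPairs_zero_of_mem hm h1 h2)
    · exact ⟨_, (mem_ballotPairs_iff_of_notMem_mem hm h1 h2).1 h, by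
        rw [Finset.insert_erase h2]⟩
  · rintro ⟨⟨A', B'⟩, h, heq⟩
    obtain ⟨rfl, rfl⟩ := Prod.mk.inj heq
    have hn := notMem_of_mem_ballotPairs hm h
    rw [mem_ballotPairs_iff_of_notMem_mem hm hn.1 (Finset.mem_insert_self _ _),
      Finset.erase_insert hn.2]
    exact h

/-- The largest colour is the last letter of the word, `+1` in the first set and `-1` in the second;
this matches the recursion of `ballotNumber`. -/
theorem ballotPairs_single_one_succ (d : ℕ) : ballotPairs (Finsupp.single N 1 + m) (d + 1) =
    (fun p : Finset ℕ × Finset ℕ => (insert N p.1, p.2)) '' ballotPairs m d ∪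
    (fun p : Finset ℕ × Finset ℕ => (p.1, insert N p.2)) '' ballotPairs m (d + 2) := by
  ext ⟨A, B⟩
  rw [Set.mem_union, Set.mem_image, Set.mem_image]
  constructor
  · intro h
    rcases mem_or_mem_of_single_one hm h with ⟨h1, h2⟩ | ⟨h1, h2⟩
    · exact Or.inl ⟨_, (mem_ballotPairs_iff_of_mem_notMem hm h1 h2).1 h, by
        rw [Finset.insert_erase h1]⟩
    · exact Or.inr ⟨_, (mem_ballotPairs_iff_of_notMem_mem hm h1 h2).1 h, by
        rw [Finset.insert_erase h2]⟩
  · rintro (⟨⟨A', B'⟩, h, heq⟩ | ⟨⟨A', B'⟩, h, heq⟩) <;>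
      obtain ⟨rfl, rfl⟩ := Prod.mk.inj heq <;>
      have hn := notMem_of_mem_ballotPairs hm h
    · rw [mem_ballotPairs_iff_of_mem_notMem hm (Finset.mem_insert_self _ _) hn.2,
        Finset.erase_insert hn.1]
      exact h
    · rw [mem_ballotPairs_iff_of_notMem_mem hm hn.1 (Finset.mem_insert_self _ _),
        Finset.erase_insert hn.2]
      exact h

theorem ballotPairs_single_two (d : ℕ) : ballotPairs (Finsupp.single N 2 + m) d =
    (fun p : Finset ℕ × Finset ℕ => (insert N p.1, insert N p.2)) '' ballotPairs m d := by
  ext ⟨A, B⟩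
  rw [Set.mem_image]
  constructor
  · intro h
    have hmem : N ∈ A ∧ N ∈ B := by
      have := (indicatorWeight_erase_add hm h.1).2
      dsimp only at this
      split_ifs at this <;> simp_all
    exact ⟨_, (mem_ballotPairs_iff_of_mem_mem hm hmem.1 hmem.2).1 h, by
      rw [Finset.insert_erase hmem.1, Finset.insert_erase hmem.2]⟩
  · rintro ⟨⟨A', B'⟩, h, heq⟩
    obtain ⟨rfl, rfl⟩ := Prod.mk.inj heq
    have hn := notMem_of_mem_ballotPairs hm h
    rw [mem_ballotPairs_iff_of_mem_mem hm (Finset.mem_insert_self _ _)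
      (Finset.mem_insert_self _ _), Finset.erase_insert hn.1, Finset.erase_insert hn.2]
    exact h

theorem ncard_ballotPairs_single_one_zero :
    (ballotPairs (Finsupp.single N 1 + m) 0).ncard = (ballotPairs m 1).ncard := by
  rw [ballotPairs_single_one_zero hm, (injOn_insert_right hm _).ncard_image]

theorem ncard_ballotPairs_single_one_succ (d : ℕ) :
    (ballotPairs (Finsupp.single N 1 + m) (d + 1)).ncard =
      (ballotPairs m d).ncard + (ballotPairs m (d + 2)).ncard := by
  rw [ballotPairs_single_one_succ hm,
    Set.ncard_union_eq ?_ ((finite_ballotPairs _ _).image _) ((finite_ballotPairs _ _).image _),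
    (injOn_insert_right hm _).ncard_image, (injOn_insert_left hm _).ncard_image]
  rw [Set.disjoint_left]
  rintro _ ⟨⟨A, B⟩, h, rfl⟩ ⟨⟨A', B'⟩, h', heq⟩
  refine (notMem_of_mem_ballotPairs hm h').1 ?_
  have hA : A' = insert N A := (Prod.mk.inj heq).1
  rw [hA]
  exact Finset.mem_insert_self _ _

theorem ncard_ballotPairs_single_two (d : ℕ) :
    (ballotPairs (Finsupp.single N 2 + m) d).ncard = (ballotPairs m d).ncard := by
  rw [ballotPairs_single_two hm, (injOn_insert_insert hm _).ncard_image]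

end recursion

/-- The number of variables that occur in a monomial with exponent `e`. -/
def multiplicityCount (m : ℕ →₀ ℕ) (e : ℕ) : ℕ :=
  (m.support.filter (m · = e)).card

theorem multiplicityCount_single_add {m : ℕ →₀ ℕ} {N : ℕ} (hN : N ∉ m.support) {b : ℕ}
    (hb : b ≠ 0) (e : ℕ) : multiplicityCount (Finsupp.single N b + m) e =
      multiplicityCount m e + if b = e then 1 else 0 := by
  have hmN : m N = 0 := Finsupp.notMem_support_iff.1 hN
  have hs : (Finsupp.single N b + m).support = insert N m.support := by
    ext x
    by_cases hx : x = N
    · subst hx; simp [hb]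
    · simp [hx]
  have hf : m.support.filter ((Finsupp.single N b + m) · = e) = m.support.filter (m · = e) := by
    refine Finset.filter_congr fun x hx => ?_
    have : N ≠ x := fun h => hN (h ▸ hx)
    simp [this]
  rw [multiplicityCount, hs, Finset.filter_insert, hf]
  simp only [Finsupp.add_apply, Finsupp.single_eq_same, hmN, add_zero]
  split_ifs with h
  · rw [Finset.card_insert_of_notMem fun h' => hN (Finset.mem_filter.1 h').1]; rfl
  · rfl

/-- Induction on the largest colour. Exponent 2 forces it into both sets and leaves the ballot
condition unchanged; exponent 1 appends a letter. -/
theorem ncard_ballotPairs {m : ℕ →₀ ℕ} (hm : ∀ x, m x ≤ 2) (d : ℕ) :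
    (ballotPairs m d).ncard = ballotNumber (multiplicityCount m 1) d := by
  induction m using Finsupp.induction_on_max generalizing d with
  | zero =>
    have hz : ∀ p ∈ ballotPairs 0 d, p = (∅, ∅) ∧ d = 0 := by
      rintro ⟨A, B⟩ ⟨h1, h2⟩
      have hAB := fun x => DFunLike.congr_fun h1 x
      simp only [Finsupp.add_apply, indicatorWeight_apply, Finsupp.zero_apply] at hAB
      have hA : A = ∅ := Finset.eq_empty_of_forall_notMem fun x hx => by simpa [hx] using hAB x
      have hB : B = ∅ := Finset.eq_empty_of_forall_notMem fun x hx => by simpa [hx] using hAB x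
      subst hA hB
      exact ⟨rfl, by simpa [eq_comm] using h2.1⟩
    cases d with
    | zero =>
      have : ballotPairs 0 0 = {(∅, ∅)} := by
        ext p
        rw [Set.mem_singleton_iff]
        refine ⟨fun h => (hz p h).1, ?_⟩
        rintro rfl
        exact ⟨by simp [indicatorWeight], by simp [IsBallot]⟩
      rw [this, Set.ncard_singleton]
      rfl
    | succ d =>
      have : ballotPairs 0 (d + 1) = ∅ :=
        Set.eq_empty_of_forall_notMem fun p hp => Nat.succ_ne_zero _ (hz p hp).2
      rw [this, Set.ncard_empty]
      rfl
  | single_add N b m hN hb ih =>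
    have hNm : N ∉ m.support := fun h => lt_irrefl _ (hN N h)
    have hb2 : b ≤ 2 := by
      have := hm N
      simp only [Finsupp.add_apply, Finsupp.single_eq_same] at this
      omega
    have ih' := ih fun x => (Nat.le_add_left _ _).trans (hm x)
    rw [multiplicityCount_single_add hNm hb]
    obtain rfl | rfl : b = 1 ∨ b = 2 := by omega
    · rw [if_pos rfl]
      cases d with
      | zero => rw [ncard_ballotPairs_single_one_zero hN, ih', ballotNumber]
      | succ d => rw [ncard_ballotPairs_single_one_succ hN, ih', ih', ballotNumber]
    · rw [if_neg (by norm_num), ncard_ballotPairs_single_two hN, ih', add_zero]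

theorem ballotPairs_eq_empty {m : ℕ →₀ ℕ} {x : ℕ} (hx : 2 < m x) (d : ℕ) :
    ballotPairs m d = ∅ := by
  refine Set.eq_empty_of_forall_notMem ?_
  rintro ⟨A, B⟩ ⟨rfl, -⟩
  simp only [Finsupp.add_apply, indicatorWeight_apply] at hx
  split_ifs at hx <;> omega

/-! ### Two-column tableaux as ballot pairs -/

theorem mem_twosOnes {C D i j : ℕ} :
    (i, j) ∈ twosOnes C D ↔ (j = 0 ∧ i < C + D) ∨ (j = 1 ∧ i < C) := by
  rw [twosOnes, YoungDiagram.mem_ofRowLens]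
  simp only [List.length_append, List.length_replicate, List.getElem_append,
    List.getElem_replicate]
  constructor
  · rintro ⟨h, h'⟩
    split_ifs at h' <;> omega
  · rintro (⟨rfl, h⟩ | ⟨rfl, h⟩)
    · refine ⟨h, ?_⟩
      split_ifs <;> omega
    · refine ⟨by omega, ?_⟩
      rw [dif_pos h]
      norm_num

theorem cells_twosOnes (C D : ℕ) : (twosOnes C D).cells =
    (Finset.range (C + D)).image (fun i => (i, 0)) ∪ (Finset.range C).image (fun i => (i, 1)) := by
  ext ⟨i, j⟩
  rw [YoungDiagram.mem_cells, mem_twosOnes]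
  simp only [Finset.mem_union, Finset.mem_image, Finset.mem_range, Prod.mk.injEq]
  constructor
  · rintro (⟨rfl, h⟩ | ⟨rfl, h⟩)
    · exact Or.inl ⟨i, h, rfl, rfl⟩
    · exact Or.inr ⟨i, h, rfl, rfl⟩
  · rintro (⟨i, h, rfl, rfl⟩ | ⟨i, h, rfl, rfl⟩)
    · exact Or.inl ⟨rfl, h⟩
    · exact Or.inr ⟨rfl, h⟩

theorem sum_cells_twosOnes {M : Type*} [AddCommMonoid M] (C D : ℕ) (f : ℕ × ℕ → M) :
    ∑ c ∈ (twosOnes C D).cells, f c =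
      ∑ i ∈ Finset.range (C + D), f (i, 0) + ∑ i ∈ Finset.range C, f (i, 1) := by
  rw [cells_twosOnes, Finset.sum_union, Finset.sum_image, Finset.sum_image]
  · intro a _ b _ h; exact (Prod.mk.inj h).1
  · intro a _ b _ h; exact (Prod.mk.inj h).1
  · rw [Finset.disjoint_left]
    intro c h1 h2
    obtain ⟨a, _, rfl⟩ := Finset.mem_image.1 h1
    obtain ⟨b, _, h⟩ := Finset.mem_image.1 h2
    exact absurd (Prod.mk.inj h).2 (by norm_num)

namespace Finset

/-- The `i`-th smallest element of a set, and `0` if there is none. -/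
noncomputable def nthSmallest (A : Finset ℕ) (i : ℕ) : ℕ :=
  Nat.nth (· ∈ A) i

variable (A : Finset ℕ)

theorem card_toFinset_ofPred_mem (hf : (Set.ofPred (· ∈ A)).Finite) : hf.toFinset.card = A.card := by
  congr 1
  ext x
  simp

theorem finite_ofPred_mem : (Set.ofPred (· ∈ A)).Finite := A.finite_toSet

variable {A}

theorem nthSmallest_lt {i j : ℕ} (h : i < j) (hj : j < A.card) :
    A.nthSmallest i < A.nthSmallest j :=
  Nat.nth_lt_nth_of_lt_card A.finite_ofPred_mem h (by rwa [card_toFinset_ofPred_mem])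

theorem nthSmallest_of_card_le {i : ℕ} (h : A.card ≤ i) : A.nthSmallest i = 0 :=
  Nat.nth_of_card_le A.finite_ofPred_mem (by rwa [card_toFinset_ofPred_mem])

theorem nthSmallest_mem {i : ℕ} (h : i < A.card) : A.nthSmallest i ∈ A :=
  Nat.nth_mem_of_lt_card A.finite_ofPred_mem (by rwa [card_toFinset_ofPred_mem])

theorem image_nthSmallest : (range A.card).image A.nthSmallest = A := by
  refine eq_of_subset_of_card_le ?_ ?_
  · intro x hx
    obtain ⟨i, hi, rfl⟩ := mem_image.1 hx
    exact nthSmallest_mem (mem_range.1 hi)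
  · rw [card_image_of_injOn, card_range]
    intro i hi j hj h
    rw [coe_range, Set.mem_Iio] at hi hj
    rcases lt_trichotomy i j with h' | h' | h'
    · exact absurd h (nthSmallest_lt h' hj).ne
    · exact h'
    · exact absurd h (nthSmallest_lt h' hi).ne'

theorem card_filter_lt_eq_count (t : ℕ) : (A.filter (· < t)).card = Nat.count (· ∈ A) t := by
  rw [Nat.count_eq_card_filter_range]
  congr 1
  ext x
  simp [and_comm]

theorem card_filter_lt_nthSmallest_add_one {i : ℕ} (h : i < A.card) :
    (A.filter (· < A.nthSmallest i + 1)).card = i + 1 := by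
  rw [card_filter_lt_eq_count]
  exact Nat.count_nth_succ fun hf => by rwa [card_toFinset_ofPred_mem]

theorem nthSmallest_lt_of_lt_card_filter {i t : ℕ} (h : i < (A.filter (· < t)).card) :
    A.nthSmallest i < t := by
  rw [card_filter_lt_eq_count] at h
  exact Nat.nth_lt_of_lt_count h

theorem card_filter_lt_eq_card_range (t : ℕ) :
    (A.filter (· < t)).card = ((range A.card).filter (A.nthSmallest · < t)).card := by
  conv_lhs => rw [← image_nthSmallest (A := A), filter_image]
  refine card_image_of_injOn fun i hi j hj h => ?_
  have hi := mem_range.1 (mem_filter.1 hi).1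
  have hj := mem_range.1 (mem_filter.1 hj).1
  rcases lt_trichotomy i j with h' | h' | h'
  · exact absurd h (nthSmallest_lt h' hj).ne
  · exact h'
  · exact absurd h (nthSmallest_lt h' hi).ne'

theorem eq_nthSmallest_image {n : ℕ} {f : ℕ → ℕ} (hf : StrictMonoOn f (Set.Iio n)) {i : ℕ}
    (hi : i < n) : ((range n).image f).nthSmallest i = f i := by
  have hcard : ((range n).image f).card = n := by
    rw [card_image_of_injOn, card_range]
    rw [coe_range]
    exact hf.injOn
  -- The characterization of `Nat.nth` used below concerns the indices below the cardinality in case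
  -- the predicate is finite; here these are `Set.Iio n`.
  have hset : {k | ∀ hp : (Set.ofPred (· ∈ (range n).image f)).Finite, k < hp.toFinset.card} =
      Set.Iio n := by
    ext k
    simp only [card_toFinset_ofPred_mem, hcard]
    exact ⟨fun h => h (finite_ofPred_mem _), fun h _ => h⟩
  have key := Nat.eq_nth_of_strictMonoOn_of_mapsTo_of_surjOn (p := (· ∈ (range n).image f)) f
  rw [hset] at key
  refine (key ?_ ?_ hf hi).symm
  · intro x hx
    obtain ⟨k, hk, rfl⟩ := mem_image.1 (show x ∈ (range n).image f from hx)
    exact ⟨k, mem_range.1 hk, rfl⟩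
  · intro k hk
    exact mem_image_of_mem f (mem_range.2 hk)

theorem sum_range_nthSmallest {M : Type*} [AddCommMonoid M] (A : Finset ℕ) (f : ℕ → M) :
    ∑ i ∈ range A.card, f (A.nthSmallest i) = ∑ x ∈ A, f x := by
  conv_rhs => rw [← image_nthSmallest (A := A)]
  rw [sum_image]
  intro i hi j hj h
  rw [coe_range, Set.mem_Iio] at hi hj
  rcases lt_trichotomy i j with h' | h' | h'
  · exact absurd h (nthSmallest_lt h' hj).ne
  · exact h'
  · exact absurd h (nthSmallest_lt h' hi).ne'

end Finset

open Finset

/-- Up to and including its `i`-th smallest element, `B` has `i + 1` elements, hence `A` has at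
least `i + 1` there. With the converse below, the ballot condition is exactly weak increase along
rows. -/
theorem IsBallot.nthSmallest_le {d : ℕ} {A B : Finset ℕ} (h : IsBallot d A B) {i : ℕ}
    (hi : i < B.card) : A.nthSmallest i ≤ B.nthSmallest i := by
  refine Nat.lt_succ_iff.1 (nthSmallest_lt_of_lt_card_filter ?_)
  have h1 := h.2 (B.nthSmallest i + 1)
  rw [card_filter_lt_nthSmallest_add_one hi] at h1
  exact h1

theorem isBallot_of_nthSmallest_le {d : ℕ} {A B : Finset ℕ} (hc : A.card = B.card + d)
    (h : ∀ i < B.card, A.nthSmallest i ≤ B.nthSmallest i) : IsBallot d A B := by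
  refine ⟨hc, fun t => ?_⟩
  rw [card_filter_lt_eq_card_range, card_filter_lt_eq_card_range]
  refine card_le_card fun i hi => ?_
  rw [mem_filter, mem_range] at hi ⊢
  exact ⟨by omega, (h i hi.1).trans_lt hi.2⟩

namespace SemistandardYoungTableau

variable {C D : ℕ}

/-- The tableau with two columns with given sets of entries. -/
noncomputable def ofColumns {A B : Finset ℕ} (h : IsBallot D A B) (hB : B.card = C) :
    SemistandardYoungTableau (twosOnes C D) where
  entry i j := if j = 0 then A.nthSmallest i else if j = 1 then B.nthSmallest i else 0
  row_weak' {i j1 j2} hj hc := by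
    rw [mem_twosOnes] at hc
    obtain ⟨rfl, hi⟩ : j2 = 1 ∧ i < C := by omega
    obtain rfl : j1 = 0 := by omega
    exact h.nthSmallest_le (hB ▸ hi)
  col_strict' {i1 i2 j} hi hc := by
    have hA := h.1
    rcases mem_twosOnes.1 hc with ⟨rfl, hc⟩ | ⟨rfl, hc⟩
    · exact nthSmallest_lt hi (by omega)
    · exact nthSmallest_lt hi (by omega)
  zeros' {i j} hc := by
    have hA := h.1
    rw [mem_twosOnes] at hc
    -- Past the last element `nthSmallest` is 0, the value required outside the diagram.
    split_ifs with h1 h2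
    · exact nthSmallest_of_card_le (by omega)
    · exact nthSmallest_of_card_le (by omega)
    · rfl

theorem ofColumns_zero {A B : Finset ℕ} (h : IsBallot D A B) (hB : B.card = C) (i : ℕ) :
    ofColumns h hB i 0 = A.nthSmallest i := rfl

theorem ofColumns_one {A B : Finset ℕ} (h : IsBallot D A B) (hB : B.card = C) (i : ℕ) :
    ofColumns h hB i 1 = B.nthSmallest i := rfl

theorem weight_ofColumns {A B : Finset ℕ} (h : IsBallot D A B) (hB : B.card = C) :
    (ofColumns h hB).weight = indicatorWeight A + indicatorWeight B := by
  rw [weight, sum_cells_twosOnes]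
  simp only [ofColumns_zero, ofColumns_one]
  have hA : C + D = A.card := by rw [h.1, hB]
  rw [hA, ← hB, sum_range_nthSmallest A fun x => Finsupp.single x 1,
    sum_range_nthSmallest B fun x => Finsupp.single x 1]
  rfl

theorem degree_weight (T : SemistandardYoungTableau (twosOnes C D)) :
    T.weight.degree = 2 * C + D := by
  rw [weight, map_sum, sum_cells_twosOnes]
  simp only [Finsupp.degree_single, sum_const, card_range, smul_eq_mul, mul_one]
  omega

/-- Columns are strictly increasing, so each is recovered by sorting its set of entries. -/
theorem exists_ofColumns_eq (T : SemistandardYoungTableau (twosOnes C D)) :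
    ∃ (A B : Finset ℕ) (h : IsBallot D A B) (hB : B.card = C), ofColumns h hB = T := by
  have mono0 : StrictMonoOn (fun i => T i 0) (Set.Iio (C + D)) := fun i _ j hj hij =>
    T.col_strict hij (mem_twosOnes.2 (Or.inl ⟨rfl, hj⟩))
  have mono1 : StrictMonoOn (fun i => T i 1) (Set.Iio C) := fun i _ j hj hij =>
    T.col_strict hij (mem_twosOnes.2 (Or.inr ⟨rfl, hj⟩))
  have hA : ((range (C + D)).image fun i => T i 0).card = C + D := by
    rw [card_image_of_injOn, card_range]
    rw [coe_range]
    exact mono0.injOn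
  have hB : ((range C).image fun i => T i 1).card = C := by
    rw [card_image_of_injOn, card_range]
    rw [coe_range]
    exact mono1.injOn
  have hbal : IsBallot D ((range (C + D)).image fun i => T i 0)
      ((range C).image fun i => T i 1) := by
    refine isBallot_of_nthSmallest_le (by rw [hA, hB]) fun i hi => ?_
    rw [hB] at hi
    rw [eq_nthSmallest_image mono0 (by omega : i < C + D), eq_nthSmallest_image mono1 hi]
    exact T.row_weak one_pos (mem_twosOnes.2 (Or.inr ⟨rfl, hi⟩))
  refine ⟨_, _, hbal, hB, ext fun i j => ?_⟩
  by_cases hc : (i, j) ∈ twosOnes C D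
  · rcases mem_twosOnes.1 hc with ⟨rfl, hi⟩ | ⟨rfl, hi⟩
    · exact eq_nthSmallest_image mono0 hi
    · exact eq_nthSmallest_image mono1 hi
  · rw [zeros _ hc, zeros _ hc]

theorem ofColumns_injective {A B A' B' : Finset ℕ} (h : IsBallot D A B) (hB : B.card = C)
    (h' : IsBallot D A' B') (hB' : B'.card = C) (heq : ofColumns h hB = ofColumns h' hB') :
    A = A' ∧ B = B' := by
  constructor
  · rw [← image_nthSmallest (A := A), ← image_nthSmallest (A := A'), h.1, h'.1, hB, hB']
    exact image_congr fun i _ => by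
      simpa only [ofColumns_zero] using congrArg (fun T : SemistandardYoungTableau (twosOnes C D) => T i 0) heq
  · rw [← image_nthSmallest (A := B), ← image_nthSmallest (A := B'), hB, hB']
    exact image_congr fun i _ => by
      simpa only [ofColumns_one] using congrArg (fun T : SemistandardYoungTableau (twosOnes C D) => T i 1) heq

theorem card_weight_eq {m : ℕ →₀ ℕ} (hm : m.degree = 2 * C + D) :
    Nat.card {T : SemistandardYoungTableau (twosOnes C D) // T.weight = m} =
      (ballotPairs m D).ncard := by
  -- The sizes have sum `2C + D` and difference `D`, which forces the second column to have length
  -- `C`.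
  have hcard : ∀ p ∈ ballotPairs m D, p.2.card = C := by
    rintro ⟨A, B⟩ ⟨h1, h2⟩
    have h3 := congrArg Finsupp.degree h1
    rw [map_add, degree_indicatorWeight, degree_indicatorWeight, hm] at h3
    have h4 := h2.1
    dsimp only at *
    omega
  symm
  rw [← Nat.card_coe_set_eq]
  refine Nat.card_eq_of_bijective (fun p => ⟨ofColumns p.2.2 (hcard p.1 p.2),
    (weight_ofColumns _ _).trans p.2.1⟩) ⟨?_, ?_⟩
  · intro p q h
    have := ofColumns_injective p.2.2 (hcard p.1 p.2) q.2.2 (hcard q.1 q.2)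
      (congrArg Subtype.val h)
    exact Subtype.ext (Prod.ext this.1 this.2)
  · rintro ⟨T, rfl⟩
    obtain ⟨A, B, h, hB, rfl⟩ := T.exists_ofColumns_eq
    exact ⟨⟨(A, B), (weight_ofColumns h hB).symm, h⟩, rfl⟩

end SemistandardYoungTableau

theorem coeff_schur_twosOnes {C D : ℕ} {m : ℕ →₀ ℕ} (hd : m.degree = 2 * C + D)
    (hm : ∀ x, m x ≤ 2) : MvPowerSeries.coeff m (schur (twosOnes C D)) =
      (ballotNumber (multiplicityCount m 1) D : ℚ) := by
  rw [coeff_schur, SemistandardYoungTableau.card_weight_eq hd, ncard_ballotPairs hm]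

theorem coeff_schur_twosOnes_of_degree_ne {C D : ℕ} {m : ℕ →₀ ℕ} (hd : m.degree ≠ 2 * C + D) :
    MvPowerSeries.coeff m (schur (twosOnes C D)) = 0 := by
  rw [coeff_schur, Nat.cast_eq_zero]
  have : IsEmpty {T : SemistandardYoungTableau (twosOnes C D) // T.weight = m} :=
    ⟨fun T => hd (T.2 ▸ T.1.degree_weight)⟩
  exact Nat.card_of_isEmpty

theorem coeff_schur_twosOnes_of_two_lt {C D : ℕ} {m : ℕ →₀ ℕ} {x : ℕ} (hx : 2 < m x) :
    MvPowerSeries.coeff m (schur (twosOnes C D)) = 0 := by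
  by_cases hd : m.degree = 2 * C + D
  · rw [coeff_schur, SemistandardYoungTableau.card_weight_eq hd, ballotPairs_eq_empty hx,
      Set.ncard_empty, Nat.cast_zero]
  · exact coeff_schur_twosOnes_of_degree_ne hd

theorem twosOnes_injective {C D C' D' : ℕ} (h : twosOnes C D = twosOnes C' D') :
    C = C' ∧ D = D' := by
  have key : ∀ c : ℕ × ℕ, c ∈ twosOnes C D ↔ c ∈ twosOnes C' D' := fun c => by rw [h]
  have h1 : ∀ i, i < C ↔ i < C' := fun i => by simpa [mem_twosOnes] using key (i, 1)
  have h0 : ∀ i, i < C + D ↔ i < C' + D' := fun i => by simpa [mem_twosOnes] using key (i, 0)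
  have hC := eq_of_forall_lt_iff h1
  have hD := eq_of_forall_lt_iff h0
  omega

/-! ### Coefficients of the chromatic symmetric function -/

/-- The exponent vector of a family of pairs of colors. -/
noncomputable def pairsWeight {n : ℕ} (f : Fin n → ℕ × ℕ) : ℕ →₀ ℕ :=
  ∑ i, (Finsupp.single (f i).1 1 + Finsupp.single (f i).2 1)

/-- The families of pairs of colors with given weight in which different pairs have no color
in common. -/
def disjointPairs (n : ℕ) (m : ℕ →₀ ℕ) : Set (Fin n → ℕ × ℕ) :=
  {f | (∀ i j, i ≠ j → (f i).1 ≠ (f j).1 ∧ (f i).1 ≠ (f j).2 ∧ (f i).2 ≠ (f j).1 ∧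
    (f i).2 ≠ (f j).2) ∧ pairsWeight f = m}

/-- The pairs of colors that can be removed as a whole from a monomial: `(a, a)` with `a` of
exponent two, or `(a, b)` with `a ≠ b` of exponent one. -/
def removablePairs (m : ℕ →₀ ℕ) : Finset (ℕ × ℕ) :=
  (m.support.filter (m · = 2)).diag ∪ (m.support.filter (m · = 1)).offDiag

theorem mem_removablePairs {m : ℕ →₀ ℕ} {p : ℕ × ℕ} : p ∈ removablePairs m ↔
    (p.1 = p.2 ∧ m p.1 = 2) ∨ (p.1 ≠ p.2 ∧ m p.1 = 1 ∧ m p.2 = 1) := by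
  simp only [removablePairs, mem_union, mem_diag, mem_offDiag, mem_filter, Finsupp.mem_support_iff]
  constructor
  · rintro (⟨h1, h2⟩ | ⟨h1, h2, h3⟩)
    · exact Or.inl ⟨h2, h1.2⟩
    · exact Or.inr ⟨h3, h1.2, h2.2⟩
  · rintro (⟨h1, h2⟩ | ⟨h1, h2, h3⟩)
    · exact Or.inl ⟨⟨by omega, h2⟩, h1⟩
    · exact Or.inr ⟨⟨by omega, h2⟩, ⟨by omega, h3⟩, h1⟩

theorem pairsWeight_cons {n : ℕ} (p : ℕ × ℕ) (g : Fin n → ℕ × ℕ) :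
    pairsWeight (Fin.cons p g : Fin (n + 1) → ℕ × ℕ) =
      (Finsupp.single p.1 1 + Finsupp.single p.2 1) + pairsWeight g := by
  rw [pairsWeight, Fin.sum_univ_succ]
  simp only [Fin.cons_zero, Fin.cons_succ]
  rfl

theorem pairsWeight_apply_eq_zero {n : ℕ} {g : Fin n → ℕ × ℕ} {x : ℕ} :
    pairsWeight g x = 0 ↔ ∀ i, x ≠ (g i).1 ∧ x ≠ (g i).2 := by
  rw [pairsWeight, Finsupp.finsetSum_apply, Finset.sum_eq_zero_iff]
  refine ⟨fun h i => ?_, fun h i _ => ?_⟩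
  · have := h i (mem_univ _)
    simp only [Finsupp.add_apply, Finsupp.single_apply] at this
    constructor <;> rintro rfl <;> simp at this
  · have := h i
    simp [Ne.symm this.1, Ne.symm this.2]

/-- The first pair uses up every occurrence of its colours, so the remaining pairs have the weight
in which these colours are erased entirely. -/
theorem cons_mem_disjointPairs_iff {n : ℕ} {m : ℕ →₀ ℕ} {p : ℕ × ℕ} {g : Fin n → ℕ × ℕ} :
    (Fin.cons p g : Fin (n + 1) → ℕ × ℕ) ∈ disjointPairs (n + 1) m ↔
      p ∈ removablePairs m ∧ g ∈ disjointPairs n ((m.erase p.1).erase p.2) := by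
  have hsplit : (∀ i j : Fin (n + 1), i ≠ j →
      ((Fin.cons p g : Fin (n + 1) → ℕ × ℕ) i).1 ≠ ((Fin.cons p g : Fin (n + 1) → ℕ × ℕ) j).1 ∧
      ((Fin.cons p g : Fin (n + 1) → ℕ × ℕ) i).1 ≠ ((Fin.cons p g : Fin (n + 1) → ℕ × ℕ) j).2 ∧
      ((Fin.cons p g : Fin (n + 1) → ℕ × ℕ) i).2 ≠ ((Fin.cons p g : Fin (n + 1) → ℕ × ℕ) j).1 ∧
      ((Fin.cons p g : Fin (n + 1) → ℕ × ℕ) i).2 ≠ ((Fin.cons p g : Fin (n + 1) → ℕ × ℕ) j).2) ↔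
      (pairsWeight g p.1 = 0 ∧ pairsWeight g p.2 = 0) ∧
      ∀ i j, i ≠ j → (g i).1 ≠ (g j).1 ∧ (g i).1 ≠ (g j).2 ∧ (g i).2 ≠ (g j).1 ∧
        (g i).2 ≠ (g j).2 := by
    rw [pairsWeight_apply_eq_zero, pairsWeight_apply_eq_zero]
    constructor
    · intro h
      refine ⟨⟨fun i => ?_, fun i => ?_⟩, fun i j hij => ?_⟩
      · have := h 0 i.succ (Fin.succ_ne_zero i).symm
        exact ⟨this.1, this.2.1⟩
      · have := h 0 i.succ (Fin.succ_ne_zero i).symm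
        exact ⟨this.2.2.1, this.2.2.2⟩
      · exact h i.succ j.succ ((Fin.succ_injective _).ne hij)
    · rintro ⟨⟨h1, h2⟩, h⟩ i j hij
      induction i using Fin.cases with
      | zero =>
        induction j using Fin.cases with
        | zero => exact absurd rfl hij
        | succ j => exact ⟨(h1 j).1, (h1 j).2, (h2 j).1, (h2 j).2⟩
      | succ i =>
        induction j using Fin.cases with
        | zero => exact ⟨(h1 i).1.symm, (h2 i).1.symm, (h1 i).2.symm, (h2 i).2.symm⟩
        | succ j => exact h i j fun h' => hij (congrArg _ h')
  have hw : (Finsupp.single p.1 1 + Finsupp.single p.2 1) + pairsWeight g = m ∧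
      (pairsWeight g p.1 = 0 ∧ pairsWeight g p.2 = 0) ↔
      p ∈ removablePairs m ∧ pairsWeight g = (m.erase p.1).erase p.2 := by
    rw [mem_removablePairs]
    constructor
    · rintro ⟨rfl, h1, h2⟩
      constructor
      · by_cases hp : p.1 = p.2
        · rw [← hp]; simp [h1]
        · simp [h1, h2, hp, Ne.symm hp]
      · ext x
        by_cases hx1 : x = p.1
        · subst hx1; by_cases hp : p.1 = p.2 <;> simp [h1, h2, hp]
        · by_cases hx2 : x = p.2
          · subst hx2; simp [h2, Finsupp.erase_apply]
          · simp [hx1, hx2]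
    · rintro ⟨hp, hg⟩
      rw [hg]
      refine ⟨?_, by simp [Finsupp.erase_apply], by simp⟩
      ext x
      rcases hp with ⟨hp, h2⟩ | ⟨hp, h1, h2⟩
      · rw [← hp]
        by_cases hx : x = p.1
        · subst hx; simp [h2]
        · simp [hx]
      · by_cases hx1 : x = p.1
        · subst hx1; simp [h1, hp]
        · by_cases hx2 : x = p.2
          · subst hx2; simp [h2, Ne.symm hp]
          · simp [hx1, hx2]
  unfold disjointPairs
  simp only [Set.mem_ofPred_eq]
  rw [hsplit, pairsWeight_cons]
  tauto

theorem finite_disjointPairs (n : ℕ) (m : ℕ →₀ ℕ) : (disjointPairs n m).Finite := by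
  refine Set.Finite.subset (Set.Finite.pi' fun _ : Fin n =>
    (m.support ×ˢ m.support).finite_toSet) ?_
  rintro f ⟨-, rfl⟩ i
  rw [mem_coe, mem_product, Finsupp.mem_support_iff, Finsupp.mem_support_iff]
  constructor
  · exact fun h => (pairsWeight_apply_eq_zero.1 h i).1 rfl
  · exact fun h => (pairsWeight_apply_eq_zero.1 h i).2 rfl

theorem ncard_disjointPairs_succ (n : ℕ) (m : ℕ →₀ ℕ) : (disjointPairs (n + 1) m).ncard =
    ∑ p ∈ removablePairs m, (disjointPairs n ((m.erase p.1).erase p.2)).ncard := by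
  have (m : ℕ →₀ ℕ) : Finite (disjointPairs n m) := finite_disjointPairs n m
  simp only [← Nat.card_coe_set_eq]
  rw [← Finset.sum_coe_sort (removablePairs m)
    fun p => Nat.card (disjointPairs n ((m.erase p.1).erase p.2)), ← Nat.card_sigma]
  symm
  refine Nat.card_eq_of_bijective (fun q => ⟨Fin.cons q.1.1 q.2.1,
    cons_mem_disjointPairs_iff.2 ⟨q.1.2, q.2.2⟩⟩) ⟨?_, ?_⟩
  · rintro ⟨⟨p, hp⟩, g, hg⟩ ⟨⟨q, hq⟩, g', hg'⟩ h
    obtain ⟨rfl, rfl⟩ := (Fin.cons_inj (α := fun _ => ℕ × ℕ)).1 (congrArg Subtype.val h)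
    rfl
  · rintro ⟨f, hf⟩
    rw [← Fin.cons_self_tail f] at hf
    have := cons_mem_disjointPairs_iff.1 hf
    exact ⟨⟨⟨_, this.1⟩, _, this.2⟩, Subtype.ext (Fin.cons_self_tail f)⟩

theorem multiplicityCount_erase {m : ℕ →₀ ℕ} {N : ℕ} (hN : m N ≠ 0) (e : ℕ) :
    multiplicityCount m e = multiplicityCount (m.erase N) e + if m N = e then 1 else 0 := by
  conv_lhs => rw [← Finsupp.single_add_erase N m]
  exact multiplicityCount_single_add (by simp) hN e

/-- Stated without division, for induction on the first pair. Let `j` and `r` be the numbers of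
colours of exponent 2 and 1. After multiplication by `(n+1-j)!`, repeated pairs contribute `j * n! *
r!` and pairs of distinct colours `(n+1-j) * n! * r!`, in total `(n+1)! * r!`. -/
theorem ncard_disjointPairs {n : ℕ} {m : ℕ →₀ ℕ} (hm : ∀ x, m x ≤ 2)
    (hn : 2 * multiplicityCount m 2 + multiplicityCount m 1 = 2 * n) :
    (disjointPairs n m).ncard * (n - multiplicityCount m 2).factorial =
      n.factorial * (multiplicityCount m 1).factorial := by
  induction n generalizing m with
  | zero =>
    have h1 : multiplicityCount m 1 = 0 := by omega
    have h2 : multiplicityCount m 2 = 0 := by omega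
    have h0 : m = 0 := by
      ext x
      by_contra hx
      have : x ∈ m.support := Finsupp.mem_support_iff.2 hx
      rw [multiplicityCount, card_eq_zero] at h1 h2
      have h1' : m x ≠ 1 := filter_eq_empty_iff.1 h1 this
      have h2' : m x ≠ 2 := filter_eq_empty_iff.1 h2 this
      have := hm x
      simp only [Finsupp.zero_apply] at hx
      omega
    subst h0
    have : disjointPairs 0 0 = Set.univ := by
      refine Set.eq_univ_of_forall fun f => ⟨fun i => i.elim0, ?_⟩
      simp [pairsWeight]
    rw [this, h1, Set.ncard_univ, Nat.card_unique]
    rfl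
  | succ n ih =>
    have hle : ∀ p : ℕ × ℕ, ∀ x, (m.erase p.1).erase p.2 x ≤ 2 := fun p x => by
      simp only [Finsupp.erase_apply]
      split_ifs
      · omega
      · omega
      · exact hm x
    have hsame : ∀ p ∈ (m.support.filter (m · = 2)).diag,
        (disjointPairs n ((m.erase p.1).erase p.2)).ncard *
          (n + 1 - multiplicityCount m 2).factorial =
        n.factorial * (multiplicityCount m 1).factorial := by
      rintro ⟨a, b⟩ hp
      obtain ⟨ha, hab⟩ := mem_diag.1 hp
      obtain rfl : a = b := hab
      have ha : m a ≠ 0 ∧ m a = 2 :=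
        ⟨Finsupp.mem_support_iff.1 (mem_filter.1 ha).1, (mem_filter.1 ha).2⟩
      have h1 := multiplicityCount_erase ha.1 1
      have h2 := multiplicityCount_erase ha.1 2
      rw [if_neg (by omega)] at h1
      rw [if_pos ha.2] at h2
      have hmem := hle (a, a)
      have heq : (m.erase a).erase a = m.erase a := by simp
      simp only [heq] at hmem ⊢
      have := ih hmem (by omega)
      rw [h1, h2, Nat.add_zero, Nat.add_sub_add_right]
      exact this
    -- The additional factor `r * (r - 1)` is the number of ordered pairs of distinct colours of
    -- exponent 1; it keeps each term in `ℕ` and is cancelled after summation.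
    have hdiff : ∀ p ∈ (m.support.filter (m · = 1)).offDiag,
        (disjointPairs n ((m.erase p.1).erase p.2)).ncard *
          (n + 1 - multiplicityCount m 2).factorial * (multiplicityCount m 1 *
          (multiplicityCount m 1 - 1)) =
        (n + 1 - multiplicityCount m 2) * n.factorial * (multiplicityCount m 1).factorial := by
      rintro ⟨a, b⟩ hp
      obtain ⟨ha, hb, hab⟩ := mem_offDiag.1 hp
      simp only [mem_filter, Finsupp.mem_support_iff] at ha hb hab
      have hb' : m.erase a b = 1 := by rw [Finsupp.erase_ne (Ne.symm hab), hb.2]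
      have a1 := multiplicityCount_erase ha.1 1
      have a2 := multiplicityCount_erase ha.1 2
      have b1 := multiplicityCount_erase (N := b) (m := m.erase a) (by omega) 1
      have b2 := multiplicityCount_erase (N := b) (m := m.erase a) (by omega) 2
      rw [if_pos ha.2] at a1
      rw [if_pos hb'] at b1
      rw [if_neg (by omega)] at a2 b2
      have key := ih (hle (a, b)) (by dsimp only; omega)
      dsimp only at key ⊢
      rw [a1, b1, a2, b2]
      simp only [Nat.add_zero, Nat.add_sub_cancel]
      set r := multiplicityCount ((m.erase a).erase b) 1
      set j := multiplicityCount ((m.erase a).erase b) 2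
      have hj : n + 1 - j = (n - j) + 1 := by omega
      rw [hj, Nat.factorial_succ (n - j), Nat.factorial_succ (r + 1), Nat.factorial_succ r]
      linear_combination ((n - j + 1) * (r + 1 + 1) * (r + 1)) * key
    have hdisj : Disjoint (m.support.filter (m · = 2)).diag
        (m.support.filter (m · = 1)).offDiag := by
      rw [disjoint_left]
      intro p h1 h2
      exact (mem_offDiag.1 h2).2.2 (mem_diag.1 h1).2
    rw [ncard_disjointPairs_succ, removablePairs, sum_union hdisj, add_mul, sum_mul, sum_mul,
      sum_congr rfl hsame, sum_const, diag_card, smul_eq_mul]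
    change multiplicityCount m 2 * _ + _ = _
    have hj : multiplicityCount m 2 ≤ n + 1 := by omega
    have hr : multiplicityCount m 1 = 2 * (n + 1 - multiplicityCount m 2) := by omega
    have hoff : ∑ p ∈ (m.support.filter (m · = 1)).offDiag,
        (disjointPairs n ((m.erase p.1).erase p.2)).ncard *
          (n + 1 - multiplicityCount m 2).factorial =
        (n + 1 - multiplicityCount m 2) * n.factorial * (multiplicityCount m 1).factorial := by
      have hcard : (m.support.filter (m · = 1)).offDiag.card =
          multiplicityCount m 1 * (multiplicityCount m 1 - 1) := by
        rw [offDiag_card, Nat.mul_sub_one]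
        rfl
      -- The factor can be cancelled only if nonzero; otherwise no such pair exists.
      rcases Nat.eq_zero_or_pos (n + 1 - multiplicityCount m 2) with h0 | h0
      · rw [h0, zero_mul, zero_mul]
        have : (m.support.filter (m · = 1)).offDiag = ∅ := by
          rw [← card_eq_zero, hcard, hr, h0, Nat.mul_zero]
        rw [this, sum_empty]
      · have hpos : 0 < multiplicityCount m 1 * (multiplicityCount m 1 - 1) :=
          Nat.mul_pos (by omega) (by omega)
        refine Nat.eq_of_mul_eq_mul_right hpos ?_
        rw [sum_mul, sum_congr rfl hdiff, sum_const, hcard, smul_eq_mul, mul_comm]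
    rw [hoff, Nat.factorial_succ]
    have hsum : multiplicityCount m 2 + (n + 1 - multiplicityCount m 2) = n + 1 := by omega
    calc _ = (multiplicityCount m 2 + (n + 1 - multiplicityCount m 2)) *
          (n.factorial * (multiplicityCount m 1).factorial) := by ring
      _ = _ := by rw [hsum]; ring

theorem le_two_of_mem_disjointPairs {n : ℕ} {m : ℕ →₀ ℕ} {f : Fin n → ℕ × ℕ}
    (hf : f ∈ disjointPairs n m) (x : ℕ) : m x ≤ 2 := by
  induction n generalizing m with
  | zero =>
    obtain ⟨-, rfl⟩ := hf
    simp [pairsWeight]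
  | succ n ih =>
    rw [← Fin.cons_self_tail f] at hf
    obtain ⟨h1, h2⟩ := cons_mem_disjointPairs_iff.1 hf
    have h3 := ih h2
    rw [mem_removablePairs] at h1
    simp only [Finsupp.erase_apply] at h3
    split_ifs at h3 with hx hx'
    · rw [hx]; rcases h1 with ⟨h, h'⟩ | h
      · rw [← h]; omega
      · omega
    · rw [hx']; omega
    · exact h3

theorem degree_of_mem_disjointPairs {n : ℕ} {m : ℕ →₀ ℕ} {f : Fin n → ℕ × ℕ}
    (hf : f ∈ disjointPairs n m) : m.degree = 2 * n := by
  obtain ⟨-, rfl⟩ := hf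
  simp [pairsWeight, map_sum, mul_comm]

theorem multipartite_two_adj {n : ℕ} {v w : DisjointChains fun _ : Fin n => 2} :
    (multipartite fun _ : Fin n => 2).Adj v w ↔ v.1 ≠ w.1 := by
  rw [multipartite_eq]
  simp

/-- The two vertices of a part are not adjacent, so properness constrains only colours of different
parts. -/
theorem card_coloring_eq (n : ℕ) (m : ℕ →₀ ℕ) :
    Nat.card {c : (multipartite fun _ : Fin n => 2).Coloring ℕ //
      ∑ v, Finsupp.single (c v) 1 = m} = (disjointPairs n m).ncard := by
  rw [← Nat.card_coe_set_eq]
  have hw (c : (multipartite fun _ : Fin n => 2).Coloring ℕ) :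
      pairsWeight (fun i => (c ⟨i, 0⟩, c ⟨i, 1⟩)) = ∑ v, Finsupp.single (c v) 1 := by
    rw [Fintype.sum_sigma, pairsWeight]
    refine sum_congr rfl fun i _ => ?_
    exact (Fin.sum_univ_two fun y : Fin 2 => Finsupp.single (c ⟨i, y⟩) 1).symm
  refine Nat.card_eq_of_bijective (fun c => ⟨fun i => (c.1 ⟨i, 0⟩, c.1 ⟨i, 1⟩), ?_, ?_⟩) ⟨?_, ?_⟩
  · intro i j hij
    refine ⟨?_, ?_, ?_, ?_⟩ <;> exact c.1.valid (multipartite_two_adj.2 hij)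
  · rw [hw, c.2]
  · rintro ⟨c, hc⟩ ⟨c', hc'⟩ h
    have key := fun i => congrFun (congrArg Subtype.val h) i
    refine Subtype.ext (DFunLike.ext _ _ ?_)
    rintro ⟨i, a⟩
    have hi := Prod.mk.inj (key i)
    fin_cases a
    · exact hi.1
    · exact hi.2
  · rintro ⟨f, hf, hm⟩
    let c : (multipartite fun _ : Fin n => 2).Coloring ℕ :=
      SimpleGraph.Coloring.mk (fun v => if v.2 = 0 then (f v.1).1 else (f v.1).2) (by
        intro v w hvw
        have := hf _ _ (multipartite_two_adj.1 hvw)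
        split_ifs
        exacts [this.1, this.2.1, this.2.2.1, this.2.2.2])
    have hc : (fun i => (c ⟨i, 0⟩, c ⟨i, 1⟩)) = f := by
      funext i
      rfl
    refine ⟨⟨c, ?_⟩, Subtype.ext hc⟩
    rw [← hw, hc, hm]

theorem coeff_chromaticSymm_multipartite (n : ℕ) (m : ℕ →₀ ℕ) :
    MvPowerSeries.coeff m (chromaticSymm (multipartite fun _ : Fin n => 2)) =
      ((disjointPairs n m).ncard : ℚ) := by
  rw [← card_coloring_eq]
  rfl

/-! ### Spanning sequences by inclusion–exclusion -/

/-- The lists containing every element of a finite set exactly once. -/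
noncomputable def Finset.arrangements {α : Type*} [DecidableEq α] (s : Finset α) :
    Finset (List α) :=
  s.toList.permutations.toFinset

theorem Finset.mem_arrangements {α : Type*} [DecidableEq α] {s : Finset α} {l : List α} :
    l ∈ s.arrangements ↔ l.Nodup ∧ ∀ x, x ∈ l ↔ x ∈ s := by
  rw [arrangements, List.mem_toFinset, List.mem_permutations]
  constructor
  · intro h
    exact ⟨h.nodup_iff.2 s.nodup_toList, fun x => by rw [h.mem_iff, mem_toList]⟩
  · rintro ⟨h1, h2⟩
    exact (List.perm_ext_iff_of_nodup h1 s.nodup_toList).2 fun x => by rw [h2, mem_toList]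

theorem Finset.card_arrangements {α : Type*} [DecidableEq α] (s : Finset α) :
    s.arrangements.card = s.card.factorial := by
  rw [arrangements, List.toFinset_card_of_nodup (List.nodup_permutations _ s.nodup_toList),
    List.length_permutations, length_toList]

section gluing

variable {n : ℕ}

/-- The lower element of the `i`-th chain is immediately followed by the upper one. -/
def Glued (i : Fin n) (l : List (DisjointChains fun _ : Fin n => 2)) : Prop :=
  [⟨i, 0⟩, ⟨i, 1⟩] <:+: l

theorem disjointChains_two_le_iff {a b : DisjointChains fun _ : Fin n => 2} (hab : a ≠ b) :
    a ≤ b ↔ ∃ i, a = ⟨i, 0⟩ ∧ b = ⟨i, 1⟩ := by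
  constructor
  · intro h
    obtain ⟨i, x⟩ := a
    obtain ⟨j, y⟩ := b
    obtain rfl : i = j := (Sigma.le_def.1 h).1
    rw [Sigma.mk_le_mk_iff] at h
    have hxy : x ≠ y := fun h => hab (h ▸ rfl)
    refine ⟨i, ?_⟩
    revert h hxy
    revert x y
    intro x y _ h hxy
    fin_cases x <;> fin_cases y <;> simp_all
  · rintro ⟨i, rfl, rfl⟩
    rw [Sigma.mk_le_mk_iff]
    exact Fin.zero_le _

/-- The only strict relations are between the two elements of a chain, and a list without repetition
has no consecutive equal entries; a forbidden step is therefore a glued chain. -/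
theorem isChain_not_le_iff {l : List (DisjointChains fun _ : Fin n => 2)} (hl : l.Nodup) :
    l.IsChain (fun a b => ¬ a ≤ b) ↔ ∀ i, ¬ Glued i l := by
  rw [List.isChain_iff_forall_rel_of_append_cons_cons]
  constructor
  · rintro h i ⟨u, v, huv⟩
    refine h (a := ⟨i, 0⟩) (b := ⟨i, 1⟩) (l₁ := u) (l₂ := v) ?_ ?_
    · rw [← huv]; simp
    · rw [Sigma.mk_le_mk_iff]
      exact Fin.zero_le _
  · rintro h a b u v rfl hle
    have hab : a ≠ b := by
      rintro rfl
      simp [List.nodup_append] at hl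
    obtain ⟨i, rfl, rfl⟩ := (disjointChains_two_le_iff hab).1 hle
    exact h i ⟨u, v, by simp⟩

variable (t : Finset (Fin n))

/-- The vertices remaining after deletion of the upper elements of the chains in `t`. -/
def lowerVertices : Finset (DisjointChains fun _ : Fin n => 2) :=
  univ.filter fun x => ¬ (x.2 = 1 ∧ x.1 ∈ t)

/-- Insert the upper elements of the chains in `t` after the lower ones. -/
def expandChain (x : DisjointChains fun _ : Fin n => 2) :
    List (DisjointChains fun _ : Fin n => 2) :=
  if x.2 = 0 ∧ x.1 ∈ t then [x, ⟨x.1, 1⟩] else [x]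

theorem card_lowerVertices : (lowerVertices t).card = 2 * n - t.card := by
  have h1 : (univ.filter fun x : DisjointChains fun _ : Fin n => 2 => x.2 = 1 ∧ x.1 ∈ t).card =
      t.card := by
    refine (card_nbij (fun i => ⟨i, 1⟩) ?_ ?_ ?_).symm
    · intro i hi
      simpa using hi
    · intro i _ j _ h
      exact congrArg Sigma.fst h
    · rintro ⟨i, a⟩ h
      obtain ⟨h1, h2⟩ : a = 1 ∧ i ∈ t := by simpa using h
      exact ⟨i, h2, by rw [h1]⟩
  have h2 := card_filter_add_card_filter_not (s := univ)
    (fun x : DisjointChains fun _ : Fin n => 2 => x.2 = 1 ∧ x.1 ∈ t)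
  have h3 : (univ : Finset (DisjointChains fun _ : Fin n => 2)).card = 2 * n := by
    simp [Fintype.card_sigma, mul_comm]
  rw [lowerVertices]
  omega

theorem mem_lowerVertices {x : DisjointChains fun _ : Fin n => 2} :
    x ∈ lowerVertices t ↔ ¬ (x.2 = 1 ∧ x.1 ∈ t) := by
  simp [lowerVertices]

theorem filter_expandChain {x : DisjointChains fun _ : Fin n => 2} (hx : x ∈ lowerVertices t) :
    (expandChain t x).filter (· ∈ lowerVertices t) = [x] := by
  unfold expandChain
  split_ifs with h
  · have : (⟨x.1, 1⟩ : DisjointChains fun _ : Fin n => 2) ∉ lowerVertices t := by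
      simp [mem_lowerVertices, h.2]
    simp [hx, this]
  · simp [hx]

theorem filter_flatMap_expandChain {l : List (DisjointChains fun _ : Fin n => 2)}
    (hl : ∀ x ∈ l, x ∈ lowerVertices t) :
    (l.flatMap (expandChain t)).filter (· ∈ lowerVertices t) = l := by
  induction l with
  | nil => rfl
  | cons x l ih =>
    rw [List.flatMap_cons, List.filter_append, filter_expandChain t (hl x List.mem_cons_self),
      ih fun y hy => hl y (List.mem_cons_of_mem _ hy), List.singleton_append]

theorem mem_expandChain {x y : DisjointChains fun _ : Fin n => 2} :
    y ∈ expandChain t x ↔ y = x ∨ (x.2 = 0 ∧ x.1 ∈ t ∧ y = ⟨x.1, 1⟩) := by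
  unfold expandChain
  split_ifs with h
  · simp [h.1, h.2]
  · simp only [List.mem_singleton]
    tauto

theorem flatMap_expandChain_mem {l : List (DisjointChains fun _ : Fin n => 2)}
    (hl : l ∈ (lowerVertices t).arrangements) :
    l.flatMap (expandChain t) ∈ (univ : Finset (DisjointChains fun _ : Fin n => 2)).arrangements ∧
      ∀ i ∈ t, Glued i (l.flatMap (expandChain t)) := by
  obtain ⟨hnd, hmem⟩ := mem_arrangements.1 hl
  have hlow : ∀ i, (⟨i, 0⟩ : DisjointChains fun _ : Fin n => 2) ∈ l := fun i => by
    rw [hmem, mem_lowerVertices]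
    simp
  refine ⟨mem_arrangements.2 ⟨?_, ?_⟩, ?_⟩
  · rw [List.nodup_flatMap]
    constructor
    · intro x hx
      unfold expandChain
      split_ifs with h
      · obtain ⟨i, a⟩ := x
        obtain rfl : a = 0 := h.1
        simp
      · simp
    · refine List.Pairwise.imp_of_mem ?_ hnd
      intro x y hx hy hxy z hzx hzy
      rw [mem_expandChain] at hzx hzy
      rw [hmem, mem_lowerVertices] at hx hy
      rcases hzx with rfl | ⟨h1, h2, rfl⟩
      · rcases hzy with rfl | ⟨h1, h2, rfl⟩
        · exact hxy rfl
        · exact hx ⟨rfl, h2⟩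
      · rcases hzy with rfl | ⟨h3, h4, h5⟩
        · exact hy ⟨rfl, h2⟩
        · obtain ⟨i, a⟩ := x
          obtain ⟨j, b⟩ := y
          obtain rfl : i = j := congrArg Sigma.fst h5
          obtain rfl : a = 0 := h1
          obtain rfl : b = 0 := h3
          exact hxy rfl
  · intro x
    simp only [mem_univ, iff_true, List.mem_flatMap, mem_expandChain]
    by_cases hx : x.2 = 1 ∧ x.1 ∈ t
    · refine ⟨⟨x.1, 0⟩, hlow _, Or.inr ⟨rfl, hx.2, ?_⟩⟩
      exact Sigma.ext rfl (heq_of_eq hx.1)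
    · exact ⟨x, (hmem x).2 ((mem_lowerVertices t).2 hx), Or.inl rfl⟩
  · intro i hi
    obtain ⟨u, v, rfl⟩ := List.append_of_mem (hlow i)
    refine ⟨u.flatMap (expandChain t), v.flatMap (expandChain t), ?_⟩
    rw [List.flatMap_append, List.flatMap_cons]
    simp [expandChain, hi]

theorem Glued.of_cons {i : Fin n} {x : DisjointChains fun _ : Fin n => 2}
    {l : List (DisjointChains fun _ : Fin n => 2)} (h : Glued i (x :: l))
    (hx : x ≠ ⟨i, 0⟩) : Glued i l := by
  rcases List.infix_cons_iff.1 h with h | h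
  · exact absurd (List.cons_prefix_cons.1 h).1.symm hx
  · exact h

theorem Glued.mem {i : Fin n} {l : List (DisjointChains fun _ : Fin n => 2)} (h : Glued i l)
    (a : Fin 2) : ⟨i, a⟩ ∈ l := by
  refine h.subset ?_
  fin_cases a <;> simp

/-- Strong induction on the length, because a glued chain at the head removes two entries at once.
-/
theorem flatMap_filter_of_glued {l : List (DisjointChains fun _ : Fin n => 2)} (hl : l.Nodup)
    (h : ∀ x ∈ l, x.1 ∈ t → Glued x.1 l) :
    (l.filter (· ∈ lowerVertices t)).flatMap (expandChain t) = l := by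
  induction hk : l.length using Nat.strong_induction_on generalizing l with
  | _ k ih =>
    rcases l with _ | ⟨⟨i, a⟩, l⟩
    · rfl
    have hnd := List.nodup_cons.1 hl
    rw [List.length_cons] at hk
    by_cases hi : i ∈ t
    · have hg : Glued i (⟨i, a⟩ :: l) := h ⟨i, a⟩ List.mem_cons_self hi
      rcases List.infix_cons_iff.1 hg with hp | hp
      · obtain ⟨h0, hp'⟩ := List.cons_prefix_cons.1 hp
        obtain rfl : (0 : Fin 2) = a := by simpa using h0
        rcases l with _ | ⟨y, l⟩
        · simp at hp'
        obtain rfl : _ = y := (List.cons_prefix_cons.1 hp').1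
        have hnd' := List.nodup_cons.1 hnd.2
        have hrec : ∀ x ∈ l, x.1 ∈ t → Glued x.1 l := fun x hx hxt => by
          have hne : x.1 ≠ i := by
            rintro rfl
            obtain ⟨j, b⟩ := x
            fin_cases b
            · exact hnd.1 (List.mem_cons_of_mem _ hx)
            · exact hnd'.1 hx
          refine Glued.of_cons (Glued.of_cons (h x ?_ hxt) ?_) ?_
          · exact List.mem_cons_of_mem _ (List.mem_cons_of_mem _ hx)
          · exact fun h' => hne (congrArg Sigma.fst h').symm
          · exact fun h' => hne (congrArg Sigma.fst h').symm
        rw [List.length_cons] at hk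
        have := ih l.length (by omega) hnd'.2 hrec rfl
        have hk1 : (⟨i, 1⟩ : DisjointChains fun _ : Fin n => 2) ∉ lowerVertices t := by
          simp [mem_lowerVertices, hi]
        have hk0 : (⟨i, 0⟩ : DisjointChains fun _ : Fin n => 2) ∈ lowerVertices t := by
          simp [mem_lowerVertices]
        rw [List.filter_cons_of_pos (by simpa using hk0),
          List.filter_cons_of_neg (by simpa using hk1), List.flatMap_cons, this]
        simp [expandChain, hi]
      -- If the glued pair occurs later in the list, the head would appear twice.
      · exact absurd (Glued.mem hp a) hnd.1
    · have hk0 : (⟨i, a⟩ : DisjointChains fun _ : Fin n => 2) ∈ lowerVertices t := by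
        simp [mem_lowerVertices, hi]
      have hrec : ∀ x ∈ l, x.1 ∈ t → Glued x.1 l := fun x hx hxt => by
        refine Glued.of_cons (h x (List.mem_cons_of_mem _ hx) hxt) ?_
        rintro h'
        have hii : i = x.1 := congrArg Sigma.fst h'
        exact hi (hii ▸ hxt)
      rw [List.filter_cons_of_pos (by simpa using hk0), List.flatMap_cons,
        ih l.length (by omega) hnd.2 hrec rfl]
      simp [expandChain, hi]

-- Contracting each glued chain of `t` to its lower element is a bijection onto the arrangements of
-- the remaining `2n - |t|` vertices; `expandChain` gives the inverse.
open Classical in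
theorem card_glued : ((univ : Finset (DisjointChains fun _ : Fin n => 2)).arrangements.filter
    fun l => ∀ i ∈ t, Glued i l).card = (2 * n - t.card).factorial := by
  rw [← card_lowerVertices, ← card_arrangements]
  refine card_nbij' (fun l => l.filter (· ∈ lowerVertices t)) (fun l => l.flatMap (expandChain t))
    ?_ ?_ ?_ ?_
  · intro l hl
    obtain ⟨h1, h2⟩ := mem_arrangements.1 (mem_filter.1 hl).1
    refine mem_arrangements.2 ⟨h1.filter _, fun x => ?_⟩
    simp [h2]
  · intro l hl
    exact mem_filter.2 (flatMap_expandChain_mem t hl)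
  · intro l hl
    obtain ⟨h1, h2⟩ := mem_filter.1 hl
    exact flatMap_filter_of_glued t (mem_arrangements.1 h1).1 fun x _ hx => h2 _ hx
  · intro l hl
    exact filter_flatMap_expandChain t fun x hx => ((mem_arrangements.1 hl).2 x).1 hx

end gluing

open Classical in
theorem numSpanningNonincreasing_eq_card (n : ℕ) :
    numSpanningNonincreasing (DisjointChains fun _ : Fin n => 2) =
      ((univ : Finset (DisjointChains fun _ : Fin n => 2)).arrangements.filter
        fun l => ∀ i, ¬ Glued i l).card := by
  rw [numSpanningNonincreasing, ← Nat.card_eq_finsetCard]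
  refine Nat.card_congr (Equiv.subtypeEquivRight fun l => ?_)
  rw [mem_filter, mem_arrangements]
  simp only [mem_univ, iff_true]
  rw [and_assoc]
  exact and_congr_right fun h => and_congr_right fun _ => isChain_not_le_iff h

theorem numSpanningNonincreasing_two (n : ℕ) :
    (numSpanningNonincreasing (DisjointChains fun _ : Fin n => 2) : ℚ) =
      ∑ i ∈ range (n + 1), (-1) ^ i * n.choose i * ((2 * n - i).factorial : ℚ) := by
  classical
  have h1 (l : List (DisjointChains fun _ : Fin n => 2)) :
      (if ∀ i, ¬ Glued i l then (1 : ℚ) else 0) =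
        ∑ t ∈ (univ : Finset (Fin n)).powerset,
          (-1) ^ t.card * if ∀ i ∈ t, Glued i l then (1 : ℚ) else 0 := by
    -- Inclusion–exclusion: the indicator is a product of factors `1 - [Glued i l]`, which expands
    -- over subsets `t`.
    have h2 : (if ∀ i, ¬ Glued i l then (1 : ℚ) else 0) =
        ∏ i, (1 + -(if Glued i l then (1 : ℚ) else 0)) := by
      split_ifs with h
      · simp [h]
      · push Not at h
        obtain ⟨i, hi⟩ := h
        exact (prod_eq_zero (mem_univ i) (by simp [hi])).symm
    rw [h2, prod_one_add]
    refine sum_congr rfl fun t _ => ?_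
    rw [prod_neg, prod_ite_zero, prod_const_one]
    congr
  rw [numSpanningNonincreasing_eq_card, card_filter, Nat.cast_sum]
  simp only [Nat.cast_ite, Nat.cast_one, Nat.cast_zero, h1]
  rw [sum_comm]
  simp only [← mul_sum, sum_boole, card_glued]
  rw [sum_powerset_apply_card (fun i => (-1 : ℚ) ^ i * ((2 * n - i).factorial : ℚ))]
  simp only [card_univ, Fintype.card_fin, nsmul_eq_mul]
  refine sum_congr rfl fun i _ => ?_
  ring

/-! ### Chebyshev polynomials and the moment functional -/

/-- The moment `(2k)! / k!` for `n = 2k`, and `0` for odd `n`. -/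
noncomputable def evenMoment (n : ℕ) : ℚ :=
  if Even n then (n.factorial : ℚ) / ((n / 2).factorial : ℚ) else 0

/-- The values of the functional with moments `evenMoment` on `x ^ j` times the `d`-th rescaled
Chebyshev polynomial of the second kind. -/
noncomputable def chebyshevMoment (d j : ℕ) : ℚ :=
  ∑ p ∈ antidiagonal d, (-1) ^ p.2 * (p.1.choose p.2 : ℚ) * evenMoment (p.1 - p.2 + j)

theorem chebyshevMoment_zero (j : ℕ) : chebyshevMoment 0 j = evenMoment j := by
  simp [chebyshevMoment]

theorem chebyshevMoment_one (j : ℕ) : chebyshevMoment 1 j = chebyshevMoment 0 (j + 1) := by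
  simp [chebyshevMoment, Nat.antidiagonal_succ, add_comm]

/-- This is `U_(d+2) + U_d = x U_(d+1)` under the functional; on coefficients it is Pascal's rule.
-/
theorem chebyshevMoment_add_two (d j : ℕ) :
    chebyshevMoment (d + 2) j + chebyshevMoment d j = chebyshevMoment (d + 1) (j + 1) := by
  simp only [chebyshevMoment]
  rw [Nat.sum_antidiagonal_succ' (n := d + 1), Nat.sum_antidiagonal_succ,
    Nat.sum_antidiagonal_succ' (n := d)]
  simp only [Nat.choose_zero_succ, Nat.cast_zero, mul_zero, zero_mul, zero_add, pow_zero,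
    Nat.choose_zero_right, Nat.cast_one, one_mul, Nat.sub_zero]
  rw [show d + 1 + 1 + j = d + 1 + (j + 1) by ring, add_assoc, ← sum_add_distrib]
  congr 1
  refine sum_congr rfl fun p _ => ?_
  rw [Nat.choose_succ_succ, Nat.add_sub_add_right, Nat.cast_add, pow_succ]
  -- Where truncated subtraction spoils the exponent, the binomial coefficient in front of it
  -- vanishes.
  rcases Nat.lt_or_ge p.2 p.1 with h | h
  · rw [show p.1 - (p.2 + 1) + (j + 1) = p.1 - p.2 + j by omega]
    ring
  · rw [Nat.choose_eq_zero_of_lt (Nat.lt_succ_of_le h)]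
    push_cast
    ring

/-- The expansion of `x^n` in the `U_d`: multiplication by `x` sends `U_d` to `U_(d+1) + U_(d-1)`,
and `U_0` to `U_1`, so the coefficients count ballot words. -/
theorem sum_ballotNumber_mul_chebyshevMoment (n j : ℕ) :
    ∑ d ∈ range (n + 1), (ballotNumber n d : ℚ) * chebyshevMoment d j = evenMoment (n + j) := by
  induction n generalizing j with
  | zero => simp [ballotNumber, chebyshevMoment_zero]
  | succ n ih =>
    rw [show n + 1 + j = n + (j + 1) by ring, ← ih (j + 1), sum_range_succ']
    simp only [ballotNumber, Nat.cast_add, add_mul, sum_add_distrib]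
    -- Words ending in `-1`, reindexed by the final sum; the two extra boundary terms vanish because
    -- a sum cannot exceed the length.
    have h1 : ∑ e ∈ range (n + 1), (ballotNumber n (e + 2) : ℚ) * chebyshevMoment (e + 1) j +
        ballotNumber n 1 * chebyshevMoment 0 j =
        ∑ e ∈ range n, (ballotNumber n (e + 1) : ℚ) * chebyshevMoment e j := by
      rw [← sum_range_succ' fun e => (ballotNumber n (e + 1) : ℚ) * chebyshevMoment e j,
        sum_range_succ, sum_range_succ, ballotNumber_eq_zero_of_lt (by omega : n < n + 1),
        ballotNumber_eq_zero_of_lt (by omega : n < n + 1 + 1)]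
      simp
    rw [add_assoc, h1, sum_range_succ', sum_range_succ' _ n, add_right_comm, ← sum_add_distrib,
      ← chebyshevMoment_one]
    congr 1
    refine sum_congr rfl fun e _ => ?_
    rw [← chebyshevMoment_add_two]
    ring

theorem chebyshevMoment_odd (k : ℕ) : chebyshevMoment (2 * k + 1) 0 = 0 := by
  refine sum_eq_zero fun p hp => ?_
  rw [HasAntidiagonal.mem_antidiagonal] at hp
  rcases Nat.lt_or_ge p.1 p.2 with h | h
  · rw [Nat.choose_eq_zero_of_lt h]
    simp
  · rw [evenMoment, if_neg, mul_zero]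
    rw [Nat.not_even_iff_odd]
    exact ⟨k - p.2, by omega⟩

/-- Termwise, `(2k-i choose i) (2k-2i)!/(k-i)! = (2k-i)!/(i! (k-i)!) = (k choose i) (2k-i)!/k!`, and
the terms with `i > k` vanish. -/
theorem chebyshevMoment_even (k : ℕ) : chebyshevMoment (2 * k) 0 =
    (numSpanningNonincreasing (DisjointChains fun _ : Fin k => 2) : ℚ) / (k.factorial : ℚ) := by
  rw [numSpanningNonincreasing_two, chebyshevMoment, ← Nat.sum_antidiagonal_swap,
    Nat.sum_antidiagonal_eq_sum_range_succ_mk]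
  simp only [Prod.fst_swap, Prod.snd_swap, Nat.add_zero]
  have hsub : range (k + 1) ⊆ range (2 * k).succ := range_subset_range.2 (by omega)
  rw [← sum_subset hsub, sum_div]
  · refine sum_congr rfl fun i hi => ?_
    obtain ⟨s, rfl⟩ := Nat.exists_eq_add_of_le (Nat.lt_succ_iff.1 (mem_range.1 hi))
    have e1 : 2 * (i + s) - i = i + 2 * s := by omega
    have e2 : i + 2 * s - i = 2 * s := by omega
    rw [e1, e2, evenMoment, if_pos (even_two_mul s), Nat.mul_div_cancel_left _ two_pos]
    have h1 : (((i + 2 * s).choose i : ℕ) : ℚ) * i.factorial * (2 * s).factorial =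
        (i + 2 * s).factorial := by
      rw [Nat.choose_symm_add]
      exact_mod_cast Nat.add_choose_mul_factorial_mul_factorial i (2 * s)
    have h2 : (((i + s).choose i : ℕ) : ℚ) * i.factorial * s.factorial = (i + s).factorial := by
      rw [Nat.choose_symm_add]
      exact_mod_cast Nat.add_choose_mul_factorial_mul_factorial i s
    have hs : (s.factorial : ℚ) ≠ 0 := Nat.cast_ne_zero.2 s.factorial_ne_zero
    have his : ((i + s).factorial : ℚ) ≠ 0 := Nat.cast_ne_zero.2 (i + s).factorial_ne_zero
    rw [← mul_div_assoc, div_eq_div_iff hs his, ← h1, ← h2]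
    ring
  · intro i _ hi
    rw [mem_range] at hi
    rw [Nat.choose_eq_zero_of_lt (by omega)]
    simp

theorem sum_range_two_mul_add_one (f : ℕ → ℚ) (n : ℕ) : ∑ d ∈ range (2 * n + 1), f d =
    ∑ k ∈ range (n + 1), f (2 * k) + ∑ k ∈ range n, f (2 * k + 1) := by
  induction n with
  | zero => simp
  | succ n ih =>
    rw [show 2 * (n + 1) + 1 = 2 * n + 1 + 1 + 1 by ring, sum_range_succ, sum_range_succ, ih,
      sum_range_succ _ (n + 1), sum_range_succ (fun k => f (2 * k + 1)) n, show 2 * (n + 1) = 2 * n + 1 + 1 by ring]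
    ring

/-- Evaluation of the functional on `x^(2n)`. The bound `M` only adds zero terms; it lets the sum
run over all shapes, whatever the number of exponents 2. -/
theorem sum_ballotNumber_mul_numSpanningNonincreasing {n M : ℕ} (h : n ≤ M) :
    ∑ k ∈ range (M + 1), (ballotNumber (2 * n) (2 * k) : ℚ) *
      ((numSpanningNonincreasing (DisjointChains fun _ : Fin k => 2) : ℚ) / (k.factorial : ℚ)) =
      ((2 * n).factorial : ℚ) / (n.factorial : ℚ) := by
  have key := sum_ballotNumber_mul_chebyshevMoment (2 * n) 0
  rw [sum_range_two_mul_add_one] at key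
  simp only [chebyshevMoment_odd, chebyshevMoment_even, mul_zero, sum_const_zero, add_zero] at key
  rw [evenMoment, if_pos (even_two_mul n), Nat.mul_div_cancel_left _ two_pos] at key
  rw [← key]
  symm
  refine sum_subset (range_subset_range.2 (by omega)) fun k _ hk => ?_
  rw [mem_range] at hk
  rw [ballotNumber_eq_zero_of_lt (by omega), Nat.cast_zero, zero_mul]

/-! ### The Schur expansion -/

theorem degree_eq_of_le_two {m : ℕ →₀ ℕ} (hm : ∀ x, m x ≤ 2) :
    m.degree = 2 * multiplicityCount m 2 + multiplicityCount m 1 := by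
  rw [Finsupp.degree_apply, multiplicityCount, multiplicityCount, card_filter, card_filter,
    mul_sum, ← sum_add_distrib]
  refine sum_congr rfl fun x hx => ?_
  have := hm x
  rw [Finsupp.mem_support_iff] at hx
  split_ifs <;> omega

/-- The Schur coefficient of the shape `(2 ^ C, 1 ^ (2 * (n - C)))`. -/
noncomputable def twoColumnCoeff (n C : ℕ) : ℚ :=
  (n.factorial : ℚ) / ((n - C).factorial : ℚ) *
    (numSpanningNonincreasing (DisjointChains fun _ : Fin (n - C) => 2) : ℚ)

/-- The Schur expansion of the chromatic symmetric function of `K_{(2 ^ n)}`. -/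
noncomputable def multipartiteSchurExpansion (n : ℕ) : YoungDiagram →₀ ℚ :=
  ∑ C ∈ range (n + 1), Finsupp.single (twosOnes C (2 * (n - C))) (twoColumnCoeff n C)

theorem multipartiteSchurExpansion_twosOnes {n C D : ℕ} (h : 2 * C + D = 2 * n) :
    multipartiteSchurExpansion n (twosOnes C D) = twoColumnCoeff n C := by
  obtain rfl : D = 2 * (n - C) := by omega
  rw [multipartiteSchurExpansion, Finsupp.finsetSum_apply, sum_eq_single C]
  · rw [Finsupp.single_eq_same]
  · intro C' _ hC'
    exact Finsupp.single_eq_of_ne fun h' => hC' (twosOnes_injective h').1.symm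
  · intro hC
    exact absurd (mem_range.2 (by omega)) hC

theorem isSchurExpansion_multipartite (n : ℕ) :
    IsSchurExpansion (chromaticSymm (multipartite fun _ : Fin n => 2))
      (multipartiteSchurExpansion n) := by
  have hsum : (multipartiteSchurExpansion n).sum (fun μ r => r • schur μ) =
      ∑ C ∈ range (n + 1), twoColumnCoeff n C • schur (twosOnes C (2 * (n - C))) := by
    rw [← Finsupp.linearCombination_apply, multipartiteSchurExpansion, map_sum]
    exact sum_congr rfl fun C _ => Finsupp.linearCombination_single _ _ _
  rw [IsSchurExpansion, hsum]
  ext m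
  rw [coeff_chromaticSymm_multipartite, map_sum]
  simp only [map_smul, smul_eq_mul]
  have hempty : ∀ h : (∀ f, f ∉ disjointPairs n m), ((disjointPairs n m).ncard : ℚ) = 0 :=
    fun h => by rw [Set.eq_empty_of_forall_notMem h, Set.ncard_empty, Nat.cast_zero]
  by_cases hd : m.degree = 2 * n
  · by_cases hm : ∀ x, m x ≤ 2
    · have hdeg := degree_eq_of_le_two hm
      rw [hd] at hdeg
      have hr : multiplicityCount m 1 = 2 * (n - multiplicityCount m 2) := by omega
      have hcard := ncard_disjointPairs hm hdeg.symm
      have key := sum_ballotNumber_mul_numSpanningNonincreasing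
        (Nat.sub_le n (multiplicityCount m 2))
      rw [← hr] at key
      have hterm : ∀ C ∈ range (n + 1), twoColumnCoeff n C *
          MvPowerSeries.coeff m (schur (twosOnes C (2 * (n - C)))) =
          n.factorial * ((ballotNumber (multiplicityCount m 1) (2 * (n - C)) : ℚ) *
          ((numSpanningNonincreasing (DisjointChains fun _ : Fin (n - C) => 2) : ℚ) /
            ((n - C).factorial : ℚ))) := fun C hC => by
        rw [mem_range] at hC
        rw [coeff_schur_twosOnes (by omega) hm, twoColumnCoeff]
        ring
      rw [sum_congr rfl hterm, ← mul_sum]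
      -- The substitution `k = n - C` turns the sum over shapes into the sum of the moment identity.
      have hrefl : ∑ C ∈ range (n + 1),
          (ballotNumber (multiplicityCount m 1) (2 * (n - C)) : ℚ) *
          ((numSpanningNonincreasing (DisjointChains fun _ : Fin (n - C) => 2) : ℚ) /
            ((n - C).factorial : ℚ)) = _ :=
        sum_range_reflect (fun k => (ballotNumber (multiplicityCount m 1) (2 * k) : ℚ) *
          ((numSpanningNonincreasing (DisjointChains fun _ : Fin k => 2) : ℚ) /
            (k.factorial : ℚ))) (n + 1)
      rw [hrefl, key, ← mul_div_assoc, eq_div_iff (Nat.cast_ne_zero.2 (Nat.factorial_ne_zero _))]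
      exact_mod_cast hcard
    · push Not at hm
      obtain ⟨x, hx⟩ := hm
      rw [hempty fun f hf => absurd (le_two_of_mem_disjointPairs hf x) (not_le.2 hx)]
      exact (sum_eq_zero fun C _ => by rw [coeff_schur_twosOnes_of_two_lt hx, mul_zero]).symm
  · rw [hempty fun f hf => hd (degree_of_mem_disjointPairs hf)]
    refine (sum_eq_zero fun C hC => ?_).symm
    rw [mem_range] at hC
    rw [coeff_schur_twosOnes_of_degree_ne (by omega), mul_zero]

theorem lemma4p7 (β : ℕ) (hβ : 1 ≤ β) :
    (∃! a : YoungDiagram →₀ ℚ,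
      IsSchurExpansion (chromaticSymm (multipartite (fun _ : Fin β => 2))) a) ∧
    (∀ C D : ℕ, 2 * C + D = 2 * β →
      schurCoeff (twosOnes C D) (chromaticSymm (multipartite (fun _ : Fin β => 2))) =
        (Nat.factorial β : ℚ) / (Nat.factorial (β - C) : ℚ) *
          (numSpanningNonincreasing (DisjointChains (fun _ : Fin (β - C) => 2)) : ℚ)) ∧
    (∀ C D : ℕ, 2 * C + D = 2 * β →
      0 ≤ schurCoeff (twosOnes C D)
        (chromaticSymm (multipartite (fun _ : Fin β => 2)))) := by
  have hexp := isSchurExpansion_multipartite β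
  have hcoeff : ∀ C D : ℕ, 2 * C + D = 2 * β →
      schurCoeff (twosOnes C D) (chromaticSymm (multipartite (fun _ : Fin β => 2))) =
        twoColumnCoeff β C := fun C D h => by
    rw [hexp.schurCoeff_eq, multipartiteSchurExpansion_twosOnes h]
  refine ⟨⟨_, hexp, fun b hb => hb.unique hexp⟩, hcoeff, fun C D h => ?_⟩
  rw [hcoeff C D h, twoColumnCoeff]
  positivity
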